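/- **Setting.** There are $K$ arms and a window $\Delta\ge 1$. A history is $h\in[K]^\Delta$, and $\#(h,a)$ is the number of occurrences of $a$ in $h$. Let $f_{\rm cong}:[K]\times\{0,\dots,\Delta\}\to(0,1]$ and $\mu\in\mathbb R^K$ be such that every mean reward $r^*(a,j)=f_{\rm cong}(a,j)\,\mu_a$ lies in $[0,1]$ (for instance $\mu_a\in[0,1]$). At round $t=1,2,\dots$ the learner, at history $h_t$ (with $h_1$ arbitrary), plays an arm $a_t$ and receives $\tilde r_t=r^*(a_t,\#(h_t,a_t))+\epsilon_t$ with $\epsilon_t$ i.i.d. $\mathcal N(0,1)$; then $h_{t+1}$ is obtained from $h_t$ by dropping its oldest entry and appending $a_t$. The learner knows neither $f_{\rm cong}$ nor $\mu$. Let $\Pi$ be the set of all maps $\pi:[K]^\Delta\to[K]$, and let $h^\pi_t$ be the histories produced by $\pi$ from $h_1$. The policy regret is $$\lambda_T=\sup_{\pi\in\Pi}\sum_{t=1}^T r^*\big(\pi(h^\pi_t),\#(h^\pi_t,\pi(h^\pi_t))\big)-\sum_{t=1}^T\tilde r_t .$$ **Algorithm (Carmab) with input $\Delta,K,\delta$.**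 It proceeds in episodes. Let episode $e$ start in round $t_e$ ($t_1=1$), let $N_e(a,j)$ be the number of rounds $\tau<t_e$ with $a_\tau=a$ and $\#(h_\tau,a_\tau)=j$, and let $\hat r_e(a,j)$ be the sum of the rewards received in those rounds divided by $\max\{1,N_e(a,j)\}$. Put $$\mathcal R_e=\Big\{r\in[0,1]^{[K]\times\{0,\dots,\Delta\}}:\ |r(a,j)-\hat r_e(a,j)|\le 10\sqrt{\tfrac{\log(K\Delta t_e/\delta)}{\max\{1,N_e(a,j)\}}}\ \text{ for all }(a,j)\Big\}.$$ The algorithm computes an optimistic policy $\tilde\pi_e$: together with some $\tilde r\in\mathcal R_e$ it maximizes the long-run average reward $\rho(\pi,r)=\lim_{n}\frac1n\sum_{t\le n}r(\pi(h^\pi_t),\#(h^\pi_t,\pi(h^\pi_t)))$ over $\pi\in\Pi$, $r\in\mathcal R_e$ and the starting history, it attains that maximum $\tilde\rho$ from every starting history, and it is an optimal policy for $\tilde r$ in the sense of the average-reward optimality equation: there is $b:[K]^\Delta\to\mathbb R$ such that, for every $h$, $\tilde\rho+b(h)=\max_a\{\tilde r(a,\#(h,a))+b(h')\}$, where $h'$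 is the history that follows $h$ when $a$ is played, and the maximum is attained at $a=\tilde\pi_e(h)$. Ties may be broken by any fixed measurable rule depending on $t_e,N_e,\hat r_e$; if $\mathcal R_e=\emptyset$, the rule may return any policy. The algorithm plays $a_t=\tilde\pi_e(h_t)$ until some pair $(a,j)$ has been visited $\max\{1,N_e(a,j)\}$ times within the episode; then the next episode begins. **Theorem (regret bound for Carmab).** There is an absolute constant $c>0$ such that for all $K$, all $\Delta\ge1$, $\delta\in(0,1)$, $T>\Delta K$, and all $f_{\rm cong},\mu,h_1$ and tie-breaking rules as above, with probability at least $1-\delta$, $$\lambda_T\le c\,\Delta^2K\log\Big(\frac{T}{\Delta K}\Big)+c\sqrt{K\Delta T\log\Big(\frac{\Delta KT}{\delta}\Big)}+c\sqrt{T\log\Big(\frac1\delta\Big)} .$$ -/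

import Mathlib

open MeasureTheory ProbabilityTheory Filter Topology

noncomputable section

namespace CongestedBandit

/-! ### The congested multi-armed bandit -/

/-- A history: the arms played in the last `Δ` rounds, oldest first. -/
abbrev Hist (K Δ : ℕ) := Fin Δ → Fin K

/-- A stationary policy: the arm to play as a function of the current history. -/
abbrev Policy (K Δ : ℕ) := Hist K Δ → Fin K

/-- Tables indexed by an arm `a` and a historical count `j ∈ {0, …, Δ}`. -/
abbrev Table (K Δ : ℕ) (α : Type) := Fin K → Fin (Δ + 1) → α

/-- `#(h, a)`: the number of times the arm `a` occurs in the history `h`. -/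
def playCount {K Δ : ℕ} (h : Hist K Δ) (a : Fin K) : Fin (Δ + 1) :=
  ⟨(Finset.univ.filter fun i => h i = a).card,
    Nat.lt_succ_of_le (by simpa using Finset.card_filter_le Finset.univ fun i => h i = a)⟩

/-- The history after playing `a`: append `a` and drop the oldest entry. -/
def nextHist {K Δ : ℕ} (h : Hist K Δ) (a : Fin K) : Hist K Δ :=
  Fin.tail (Fin.snoc (α := fun _ => Fin K) h a)

/-- The history after `t` rounds of following the policy `π` from the history `h₁`. -/
def policyHist {K Δ : ℕ} (π : Policy K Δ) (h₁ : Hist K Δ) : ℕ → Hist K Δ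
  | 0 => h₁
  | t + 1 => nextHist (policyHist π h₁ t) (π (policyHist π h₁ t))

/-- The mean reward table `(a, j) ↦ f(a, j) · μ_a`. -/
def meanReward {K Δ : ℕ} (f : Table K Δ ℝ) (μ : Fin K → ℝ) : Table K Δ ℝ :=
  fun a j => f a j * μ a

/-- The reward `r(a, #(h, a))` of playing `a` at the history `h`, for a reward table `r`. -/
def rewardAt {K Δ : ℕ} (r : Table K Δ ℝ) (h : Hist K Δ) (a : Fin K) : ℝ :=
  r a (playCount h a)

/-- The total reward collected by `π` in the first `n` rounds, started from the history `h`. -/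
def cumReward {K Δ : ℕ} (π : Policy K Δ) (r : Table K Δ ℝ) (h : Hist K Δ) (n : ℕ) : ℝ :=
  ∑ t ∈ Finset.range n, rewardAt r (policyHist π h t) (π (policyHist π h t))

/-- The policy regret after `T` rounds of a learner that started at the history `h₁` and
received the rewards `x 0, …, x (T - 1)`, against the best stationary policy. -/
def policyRegret {K Δ : ℕ} (r : Table K Δ ℝ) (h₁ : Hist K Δ) (x : ℕ → ℝ) (T : ℕ) : ℝ :=
  (⨆ π : Policy K Δ, cumReward π r h₁ T) - ∑ t ∈ Finset.range T, x t

/-! ### Optimistic policies -/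

/-- The long-run average reward of `π`, started from the history `h`, is `ρ`. -/
def HasAvgReward {K Δ : ℕ} (π : Policy K Δ) (r : Table K Δ ℝ) (h : Hist K Δ) (ρ : ℝ) : Prop :=
  Tendsto (fun n : ℕ => cumReward π r h n / n) atTop (𝓝 ρ)

/-- The average reward optimality equation for the reward table `r`, with gain `ρ` and some
bias function `b`, the policy `π` attaining the maximum over the arms at every history. -/
def SolvesOptimalityEq {K Δ : ℕ} (π : Policy K Δ) (r : Table K Δ ℝ) (ρ : ℝ) : Prop :=
  ∃ b : Hist K Δ → ℝ, ∀ h : Hist K Δ,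
    ρ + b h = rewardAt r h (π h) + b (nextHist h (π h)) ∧
    ∀ a : Fin K, rewardAt r h a + b (nextHist h a) ≤ ρ + b h

/-- `π` is an optimistic policy for the set `R` of reward tables: together with some `r ∈ R` it
maximizes the average reward over all policies and all tables in `R`, and it is an optimal
policy for `r` in the sense of the average reward optimality equation. -/
def IsOptimistic {K Δ : ℕ} (R : Set (Table K Δ ℝ)) (π : Policy K Δ) : Prop :=
  ∃ r ∈ R, ∃ ρ : ℝ,
    (∀ h, HasAvgReward π r h ρ) ∧
    (∀ π' : Policy K Δ, ∀ r' ∈ R, ∀ h ρ', HasAvgReward π' r' h ρ' → ρ' ≤ ρ) ∧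
    SolvesOptimalityEq π r ρ

/-! ### The algorithm -/

/-- The feasible rewards of an episode that starts in round `t`, with visit counts `N` and
empirical rewards `rhat`. -/
def feasible {K Δ : ℕ} (δ : ℝ) (t : ℕ) (N : Table K Δ ℕ) (rhat : Table K Δ ℝ) :
    Set (Table K Δ ℝ) :=
  {r | ∀ a j, r a j ∈ Set.Icc (0 : ℝ) 1 ∧
    |r a j - rhat a j| ≤ 10 * √(Real.log (K * Δ * t / δ) / (max 1 (N a j) : ℕ))}

/-- A rule that computes the policy of an episode from the round `t` in which the episode
starts, the visit counts and the empirical rewards. -/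
abbrev PolicyRule (K Δ : ℕ) := ℕ → Table K Δ ℕ → Table K Δ ℝ → Policy K Δ

/-- The rule returns an optimistic policy whenever the set of feasible rewards is nonempty
(otherwise any policy), ties being broken in any measurable way. -/
structure IsOptimisticRule {K Δ : ℕ} (δ : ℝ) (sel : PolicyRule K Δ) : Prop where
  measurable : ∀ t N, Measurable (sel t N)
  optimistic : ∀ t N rhat, (feasible δ t N rhat).Nonempty →
    IsOptimistic (feasible δ t N rhat) (sel t N rhat)

/-- The state of the algorithm at the beginning of a round. -/
structure State (K Δ : ℕ) where
  /-- the number of the round, starting from `1` -/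
  round : ℕ
  /-- the current history -/
  hist : Hist K Δ
  /-- the policy of the current episode -/
  policy : Policy K Δ
  /-- the sum of all rewards received so far at each pair `(a, j)` -/
  rewardSum : Table K Δ ℝ
  /-- the number of visits to `(a, j)` in the episodes before the current one -/
  oldCount : Table K Δ ℕ
  /-- the number of visits to `(a, j)` in the current episode -/
  newCount : Table K Δ ℕ

/-- The arm that is played. -/
def State.arm {K Δ : ℕ} (s : State K Δ) : Fin K := s.policy s.hist

/-- Add `x` to the entry `(a, j)` of a table. -/
def addAt {K Δ : ℕ} {α : Type} [Add α] (v : Table K Δ α) (a : Fin K) (j : Fin (Δ + 1)) (x : α) :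
    Table K Δ α :=
  fun a' j' => if a' = a ∧ j' = j then v a' j' + x else v a' j'

/-- Empirical rewards from the sums of the rewards and the visit counts. -/
def empirical {K Δ : ℕ} (S : Table K Δ ℝ) (N : Table K Δ ℕ) : Table K Δ ℝ :=
  fun a j => S a j / (max 1 (N a j) : ℕ)

/-- Begin a new episode: the visits of the episode that ended join the old ones, and a new
policy is computed. -/
def State.newEpisode {K Δ : ℕ} (sel : PolicyRule K Δ) (s : State K Δ) : State K Δ :=
  let N : Table K Δ ℕ := fun a j => s.oldCount a j + s.newCount a j
  { s with
    oldCount := N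
    newCount := fun _ _ => 0
    policy := sel s.round N (empirical s.rewardSum N) }

/-- Record the reward `x` received in the current round and move to the next round, within the
episode. -/
def State.record {K Δ : ℕ} (s : State K Δ) (x : ℝ) : State K Δ :=
  { s with
    round := s.round + 1
    hist := nextHist s.hist s.arm
    rewardSum := addAt s.rewardSum s.arm (playCount s.hist s.arm) x
    newCount := addAt s.newCount s.arm (playCount s.hist s.arm) 1 }

/-- One round, with reward `x`. The episode goes on as long as every pair `(a, j)` has fewer
visits in it than `max {1, number of visits before it}`. -/
def State.step {K Δ : ℕ} (sel : PolicyRule K Δ) (s : State K Δ) (x : ℝ) : State K Δ :=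
  if ∀ a j, (s.record x).newCount a j < max 1 ((s.record x).oldCount a j) then s.record x
  else (s.record x).newEpisode sel

/-- The state at the beginning of the first round. -/
def State.first {K Δ : ℕ} (sel : PolicyRule K Δ) (h₁ : Hist K Δ) : State K Δ where
  round := 1
  hist := h₁
  policy := sel 1 (fun _ _ => 0) (empirical (fun _ _ => 0) fun _ _ => 0)
  rewardSum := fun _ _ => 0
  oldCount := fun _ _ => 0
  newCount := fun _ _ => 0

/-- The state of the algorithm after `t` rounds, when the mean rewards are `r` and the noise in
round `t + 1` is `ε t`. -/
def carmabState {K Δ : ℕ} (sel : PolicyRule K Δ) (r : Table K Δ ℝ) (h₁ : Hist K Δ)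
    (ε : ℕ → ℝ) : ℕ → State K Δ
  | 0 => State.first sel h₁
  | t + 1 =>
    let s := carmabState sel r h₁ ε t
    s.step sel (rewardAt r s.hist s.arm + ε t)

/-- The noisy reward that the algorithm receives in round `t + 1`. -/
def carmabReward {K Δ : ℕ} (sel : PolicyRule K Δ) (r : Table K Δ ℝ) (h₁ : Hist K Δ)
    (ε : ℕ → ℝ) (t : ℕ) : ℝ :=
  rewardAt r (carmabState sel r h₁ ε t).hist (carmabState sel r h₁ ε t).arm + ε t

end CongestedBandit

end

open CongestedBandit

noncomputable section

namespace CongestedBandit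

/-! The histories form a deterministic decision process in which any history is reached from any
other in exactly `Δ` rounds. This has two consequences. A closed walk splits into simple cycles,
each of which a stationary policy can run, so it earns at most its length times the best average
reward `ρ`; closing up a path takes `Δ` more rounds, so no policy earns more than `T ρ + Δ` in `T`
rounds (`cumReward_le_of_avgReward_le`). Also, the bias in the optimality equation has span at most
`Δ` (`bias_le_add`).

If the true rewards are feasible when an episode begins, its optimistic gain is at least `g`, the
competitor's total less `Δ`, divided by `T`. The optimality equation, read with the true rewards,
bounds `g` by the reward of the round plus a confidence width plus an increment of the bias
(`exists_isCertificate`). Along the run the bias telescopes within an episode, and each change of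
episode costs at most `Δ` (`gain_le_of_trueFeasible`). The widths are paid for by the growth of `∑
√N` over all pairs, the changes of episode by the growth of `∑ log (N + 1)`. Both potentials are
concave in the counts, hence largest when the visits are spread evenly.

Whether a pair is visited in a round is decided by the earlier noise alone. The noise gathered at a
pair therefore has an exponential martingale, and Chernoff's bound with a union over times, pairs
and counts makes the true rewards feasible throughout, up to probability `δ / 2`
(`measureReal_not_trueFeasible_le`). The sum of all the noise uses up the other `δ / 2`. -/

variable {K Δ : ℕ}

/-! ### Walks on the set of histories -/

lemma nextHist_apply (h : Hist K Δ) (a : Fin K) (i : Fin Δ) :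
    nextHist h a i = if hi : (i : ℕ) + 1 < Δ then h ⟨i + 1, hi⟩ else a := by
  unfold nextHist Fin.tail Fin.snoc
  by_cases hi : (i : ℕ) + 1 < Δ
  · simp [hi]; rfl
  · simp [hi]

/-- The history after playing the first `n` arms of the sequence `a` from the history `h`. -/
def walk (h : Hist K Δ) (a : ℕ → Fin K) : ℕ → Hist K Δ
  | 0 => h
  | n + 1 => nextHist (walk h a n) (a n)

/-- The reward collected by playing the first `n` arms of `a` from `h`. -/
def walkReward (r : Table K Δ ℝ) (h : Hist K Δ) (a : ℕ → Fin K) (n : ℕ) : ℝ :=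
  ∑ t ∈ Finset.range n, rewardAt r (walk h a t) (a t)

lemma walk_apply (h : Hist K Δ) (a : ℕ → Fin K) (n : ℕ) (i : Fin Δ) :
    walk h a n i = if hi : (i : ℕ) + n < Δ then h ⟨i + n, hi⟩ else a (i + n - Δ) := by
  induction n generalizing i with
  | zero => simp [walk]
  | succ n ih =>
    rw [walk, nextHist_apply]
    by_cases h1 : (i : ℕ) + 1 < Δ
    · rw [dif_pos h1, ih]
      by_cases h2 : (i : ℕ) + (n + 1) < Δ
      · rw [dif_pos h2, dif_pos (by simp only; omega)]
        congr 2; simp only; omega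
      · rw [dif_neg h2, dif_neg (by simp only; omega)]
        congr 1; simp only; omega
    · rw [dif_neg h1, dif_neg (by omega)]
      congr 1; omega

lemma walk_congr (h : Hist K Δ) {a a' : ℕ → Fin K} {n : ℕ} (haa : ∀ i < n, a i = a' i) :
    walk h a n = walk h a' n := by
  induction n with
  | zero => rfl
  | succ n ih => rw [walk, walk, ih fun i hi => haa i (by omega), haa n (by omega)]

lemma walk_add (h : Hist K Δ) (a : ℕ → Fin K) (m n : ℕ) :
    walk h a (m + n) = walk (walk h a m) (fun i => a (m + i)) n := by
  induction n with
  | zero => rfl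
  | succ n ih => rw [← add_assoc, walk, walk, ih]

lemma walkReward_congr (r : Table K Δ ℝ) (h : Hist K Δ) {a a' : ℕ → Fin K} {n : ℕ}
    (haa : ∀ i < n, a i = a' i) : walkReward r h a n = walkReward r h a' n := by
  refine Finset.sum_congr rfl fun t ht => ?_
  rw [Finset.mem_range] at ht
  rw [walk_congr h fun i hi => haa i (hi.trans ht), haa t ht]

lemma walkReward_add (r : Table K Δ ℝ) (h : Hist K Δ) (a : ℕ → Fin K) (m n : ℕ) :
    walkReward r h a (m + n) =
      walkReward r h a m + walkReward r (walk h a m) (fun i => a (m + i)) n := by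
  simp only [walkReward, Finset.sum_range_add, walk_add]

lemma walkReward_nonneg {r : Table K Δ ℝ} (hr : ∀ a j, r a j ∈ Set.Icc (0 : ℝ) 1)
    (h : Hist K Δ) (a : ℕ → Fin K) (n : ℕ) : 0 ≤ walkReward r h a n :=
  Finset.sum_nonneg fun _ _ => (hr _ _).1

lemma policyHist_eq_walk (π : Policy K Δ) (h : Hist K Δ) (n : ℕ) :
    policyHist π h n = walk h (fun t => π (policyHist π h t)) n := by
  induction n with
  | zero => rfl
  | succ n ih => rw [walk, ← ih, policyHist]

lemma cumReward_eq_walkReward (π : Policy K Δ) (r : Table K Δ ℝ) (h : Hist K Δ) (n : ℕ) :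
    cumReward π r h n = walkReward r h (fun t => π (policyHist π h t)) n := by
  simp only [cumReward, walkReward, ← policyHist_eq_walk]

lemma cumReward_le {r : Table K Δ ℝ} (hr : ∀ a j, r a j ∈ Set.Icc (0 : ℝ) 1)
    (π : Policy K Δ) (h : Hist K Δ) (n : ℕ) : cumReward π r h n ≤ n := by
  calc cumReward π r h n ≤ ∑ _t ∈ Finset.range n, (1 : ℝ) :=
        Finset.sum_le_sum fun _ _ => (hr _ _).2
    _ = n := by simp

lemma cumReward_nonneg {r : Table K Δ ℝ} (hr : ∀ a j, r a j ∈ Set.Icc (0 : ℝ) 1)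
    (π : Policy K Δ) (h : Hist K Δ) (n : ℕ) : 0 ≤ cumReward π r h n :=
  Finset.sum_nonneg fun _ _ => (hr _ _).1

/-- Every history `h'` is reached from every history in `Δ` rounds. -/
lemma walk_to (h h' : Hist K Δ) (a : ℕ → Fin K) (ha : ∀ i : Fin Δ, a i = h' i) :
    walk h a Δ = h' := by
  funext i
  rw [walk_apply, dif_neg (by omega), Nat.add_sub_cancel, ha]

lemma HasAvgReward.le_one {π : Policy K Δ} {r : Table K Δ ℝ} {h : Hist K Δ} {ρ : ℝ}
    (hr : ∀ a j, r a j ∈ Set.Icc (0 : ℝ) 1) (hρ : HasAvgReward π r h ρ) : ρ ≤ 1 :=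
  le_of_tendsto' hρ fun n => div_le_one_of_le₀ (cumReward_le hr π h n) n.cast_nonneg

lemma policyHist_add (π : Policy K Δ) (h : Hist K Δ) (m n : ℕ) :
    policyHist π h (m + n) = policyHist π (policyHist π h m) n := by
  induction n with
  | zero => rfl
  | succ n ih => rw [← add_assoc, policyHist, policyHist, ih]

lemma cumReward_add (π : Policy K Δ) (r : Table K Δ ℝ) (h : Hist K Δ) (m n : ℕ) :
    cumReward π r h (m + n) = cumReward π r h m + cumReward π r (policyHist π h m) n := by
  simp only [cumReward, Finset.sum_range_add, policyHist_add]

/-- The average reward of a policy that returns to its starting history. -/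
lemma hasAvgReward_of_policyHist_eq {π : Policy K Δ} {r : Table K Δ ℝ} {h : Hist K Δ} {n : ℕ}
    (hr : ∀ a j, r a j ∈ Set.Icc (0 : ℝ) 1) (hn : 0 < n) (hret : policyHist π h n = h) :
    HasAvgReward π r h (cumReward π r h n / n) := by
  have hmul : ∀ m : ℕ, cumReward π r h (n * m) = m * cumReward π r h n ∧
      policyHist π h (n * m) = h := by
    intro m
    induction m with
    | zero => simp [cumReward, policyHist]
    | succ m ih =>
      rw [mul_add, mul_one, cumReward_add, policyHist_add, ih.1, ih.2]
      refine ⟨?_, hret⟩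
      push_cast; ring
  have hn' : (0 : ℝ) < n := by exact_mod_cast hn
  -- Complete periods earn exactly the cycle average, so only the last, incomplete period can
  -- deviate from it.
  have hdev : ∀ N : ℕ, |cumReward π r h N - N * (cumReward π r h n / n)| ≤ n := by
    intro N
    have hsplit : cumReward π r h N = (N / n : ℕ) * cumReward π r h n
        + cumReward π r h (N % n) := by
      conv_lhs => rw [← Nat.div_add_mod N n]
      rw [cumReward_add, (hmul _).1, (hmul _).2]
    have hN : (N : ℝ) = n * (N / n : ℕ) + (N % n : ℕ) := by
      exact_mod_cast (Nat.div_add_mod N n).symm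
    have h1 := cumReward_le hr π h (N % n)
    have h2 := cumReward_nonneg hr π h (N % n)
    have h3 : ((N % n : ℕ) : ℝ) ≤ n := by exact_mod_cast (Nat.mod_lt N hn).le
    have h4 : 0 ≤ cumReward π r h n / n := div_nonneg (cumReward_nonneg hr π h n) hn'.le
    have h5 : cumReward π r h n / n ≤ 1 := div_le_one_of_le₀ (cumReward_le hr π h n) hn'.le
    have h6 : (0 : ℝ) ≤ (N % n : ℕ) := Nat.cast_nonneg _
    have h7 : cumReward π r h N - N * (cumReward π r h n / n)
        = cumReward π r h (N % n) - (N % n : ℕ) * (cumReward π r h n / n) := by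
      rw [hsplit, hN]; field_simp; ring
    rw [h7, abs_le]
    constructor <;> nlinarith
  unfold HasAvgReward
  rw [tendsto_iff_norm_sub_tendsto_zero]
  refine squeeze_zero' (Eventually.of_forall fun _ => norm_nonneg _) ?_
    (tendsto_const_div_atTop_nhds_zero_nat (n : ℝ))
  filter_upwards [eventually_gt_atTop 0] with N hN
  have hN' : (0 : ℝ) < N := by exact_mod_cast hN
  have : cumReward π r h N / N - cumReward π r h n / n
      = (cumReward π r h N - N * (cumReward π r h n / n)) / N := by field_simp
  rw [this, Real.norm_eq_abs, abs_div, abs_of_pos hN']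
  gcongr
  exact hdev N

/-- A closed walk collects at most its length times any bound on the average rewards of the
stationary policies. -/
lemma walkReward_le_of_closed {r : Table K Δ ℝ} (hr : ∀ a j, r a j ∈ Set.Icc (0 : ℝ) 1) {ρ : ℝ}
    (hρ : ∀ (π : Policy K Δ) h ρ', HasAvgReward π r h ρ' → ρ' ≤ ρ) (n : ℕ) :
    ∀ (h : Hist K Δ) (a : ℕ → Fin K), walk h a n = h → walkReward r h a n ≤ n * ρ := by
  induction n using Nat.strong_induction_on with
  | _ n ih =>
    intro h a hclosed
    rcases Nat.eq_zero_or_pos n with rfl | hn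
    · simp [walkReward]
    -- A history repeated before the end bounds a loop. The loop and the walk with the loop cut out
    -- are both closed and shorter, so the induction applies to each.
    by_cases hrep : ∃ i d, 0 < d ∧ i + d < n ∧ walk h a (i + d) = walk h a i
    · obtain ⟨i, d, hd, hid, heq⟩ := hrep
      obtain ⟨m, rfl⟩ : ∃ m, n = i + d + m := ⟨n - (i + d), by omega⟩
      have hloop := ih d (by omega) (walk h a i) (fun k => a (i + k)) (by rw [← walk_add, heq])
      set a' : ℕ → Fin K := fun k => if k < i then a k else a (k + d) with ha'
      have hfst : ∀ k < i, a' k = a k := fun k hk => by simp [ha', hk]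
      have hsnd : (fun k => a' (i + k)) = fun k => a (i + d + k) := by
        funext k
        simp only [ha', if_neg (by omega : ¬ i + k < i)]
        congr 1; omega
      have hw : walk h a' i = walk h a i := walk_congr h hfst
      have hrest := ih (i + m) (by omega) h a' (by
        rw [walk_add, hw, hsnd, ← heq, ← walk_add, hclosed])
      rw [walkReward_add, walkReward_congr r h hfst, hw, hsnd] at hrest
      rw [walkReward_add, walkReward_add, heq]
      push_cast at hrest ⊢
      linarith
    · push Not at hrep
      have hinj : ∀ i j, i < n → j < n → walk h a i = walk h a j → i = j := by
        intro i j hi hj hij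
        rcases lt_trichotomy i j with hlt | heq | hlt
        · exact absurd hij.symm (by
            have := hrep i (j - i) (by omega) (by omega)
            rwa [Nat.add_sub_cancel' hlt.le] at this)
        · exact heq
        · exact absurd hij (by
            have := hrep j (i - j) (by omega) (by omega)
            rwa [Nat.add_sub_cancel' hlt.le] at this)
      classical
      -- The histories on the walk are now distinct, so the arm is a function of the history and a
      -- stationary policy runs the cycle. The value `a 0` off the cycle is immaterial.
      let π : Policy K Δ := fun g =>
        if hg : ∃ i, i < n ∧ walk h a i = g then a hg.choose else a 0
      have hπ : ∀ i < n, π (walk h a i) = a i := by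
        intro i hi
        have hg : ∃ j, j < n ∧ walk h a j = walk h a i := ⟨i, hi, rfl⟩
        simp only [π, dif_pos hg]
        rw [hinj _ _ hg.choose_spec.1 hi hg.choose_spec.2]
      have hfollow : ∀ i ≤ n, policyHist π h i = walk h a i := by
        intro i
        induction i with
        | zero => intro _; rfl
        | succ i ih' =>
          intro hi
          rw [policyHist, walk, ih' (by omega), hπ i (by omega)]
      have hcum : cumReward π r h n = walkReward r h a n := by
        refine Finset.sum_congr rfl fun t ht => ?_
        rw [Finset.mem_range] at ht
        rw [hfollow t ht.le, hπ t ht]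
      have hn' : (0 : ℝ) < n := by exact_mod_cast hn
      have := hρ π h _ (hasAvgReward_of_policyHist_eq hr hn
        ((hfollow n le_rfl).trans hclosed))
      rw [hcum, div_le_iff₀ hn'] at this
      linarith

/-- In finite time no policy beats the optimal average reward by more than `Δ`. -/
lemma cumReward_le_of_avgReward_le {r : Table K Δ ℝ} (hr : ∀ a j, r a j ∈ Set.Icc (0 : ℝ) 1)
    {ρ : ℝ} (hρ1 : ρ ≤ 1)
    (hρ : ∀ (π : Policy K Δ) h ρ', HasAvgReward π r h ρ' → ρ' ≤ ρ) (π : Policy K Δ)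
    (h : Hist K Δ) (T : ℕ) : cumReward π r h T ≤ T * ρ + Δ := by
  rcases Nat.eq_zero_or_pos Δ with hΔ | hΔ
  · subst hΔ
    have := walkReward_le_of_closed hr hρ T h (fun t => π (policyHist π h t))
      (Subsingleton.elim _ _)
    rw [cumReward_eq_walkReward]
    simpa using this
  -- After round `T` the entries of `h` are replayed in order, which closes the walk. These `Δ`
  -- rounds earn at least `0`, while the bound on the closed walk grows by `Δ ρ ≤ Δ`.
  let a : ℕ → Fin K := fun i =>
    if i < T then π (policyHist π h i) else h ⟨(i - T) % Δ, Nat.mod_lt _ hΔ⟩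
  have hfst : ∀ i < T, a i = π (policyHist π h i) := fun i hi => by simp [a, hi]
  have hclosed : walk h a (T + Δ) = h := by
    rw [walk_add]
    refine walk_to _ _ _ fun i => ?_
    simp [a, Nat.mod_eq_of_lt i.2]
  have := walkReward_le_of_closed hr hρ (T + Δ) h a hclosed
  rw [walkReward_add, walkReward_congr r h hfst, ← cumReward_eq_walkReward] at this
  have h0 := walkReward_nonneg hr (walk h a T) (fun i => a (T + i)) Δ
  have hΔρ : (Δ : ℝ) * ρ ≤ Δ := mul_le_of_le_one_right (Nat.cast_nonneg _) hρ1
  push_cast at this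
  nlinarith

/-! ### Optimism -/

/-- The bias function of the optimality equation has span at most `Δ`. -/
lemma bias_le_add {r : Table K Δ ℝ} (hr : ∀ a j, r a j ∈ Set.Icc (0 : ℝ) 1) {ρ : ℝ}
    (hρ1 : ρ ≤ 1) {b : Hist K Δ → ℝ}
    (hb : ∀ h a, rewardAt r h a + b (nextHist h a) ≤ ρ + b h) (h h' : Hist K Δ) :
    b h' ≤ b h + Δ := by
  -- One round raises `b` by at most `ρ` minus a nonnegative reward, hence by at most `1`.
  have hwalk : ∀ (a : ℕ → Fin K) (n : ℕ), b (walk h a n) ≤ b h + n := by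
    intro a n
    induction n with
    | zero => simp [walk]
    | succ n ih =>
      have h1 := hb (walk h a n) (a n)
      have h2 : 0 ≤ rewardAt r (walk h a n) (a n) := (hr _ _).1
      rw [walk]; push_cast; linarith
  rcases Nat.eq_zero_or_pos Δ with hΔ | hΔ
  · subst hΔ
    rw [Subsingleton.elim h' h]; simp
  have := hwalk (fun i => h' ⟨i % Δ, Nat.mod_lt _ hΔ⟩) Δ
  rwa [walk_to h h' _ fun i => by simp [Nat.mod_eq_of_lt i.2]] at this

/-- The function `b` witnesses that `π` gains `g` per round up to the bonuses `w`. -/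
def IsCertificate (g : ℝ) (r w : Table K Δ ℝ) (π : Policy K Δ) (b : Hist K Δ → ℝ) : Prop :=
  ∀ h, 0 ≤ b h ∧ b h ≤ Δ ∧
    g + b h ≤ rewardAt r h (π h) + rewardAt w h (π h) + b (nextHist h (π h))

/-- The width of the confidence interval at `n` samples, for the confidence level `L`. -/
def width (L : ℝ) (n : ℕ) : ℝ := 20 * √(L / (max 1 n : ℕ))

lemma width_mono {L L' : ℝ} (hL : L ≤ L') (n : ℕ) : width L n ≤ width L' n := by
  unfold width; gcongr

/-- The optimistic gain dominates every average reward under the true table, so the finite-horizon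
comparison puts `g` below it. Subtracting its minimum brings the bias into `[0, Δ]`. -/
lemma exists_isCertificate {δ : ℝ} {t : ℕ} {N : Table K Δ ℕ} {rhat r : Table K Δ ℝ}
    {π₀ π : Policy K Δ} {h₁ : Hist K Δ} {T : ℕ} (hT : 0 < T) (hr : r ∈ feasible δ t N rhat)
    (hπ : IsOptimistic (feasible δ t N rhat) π) :
    ∃ b, IsCertificate ((cumReward π₀ r h₁ T - Δ) / T) r
      (fun a j => width (Real.log (K * Δ * t / δ)) (N a j)) π b := by
  obtain ⟨r', hr', ρ, havg, hmax, b, hb⟩ := hπ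
  have hr01 : ∀ a j, r a j ∈ Set.Icc (0 : ℝ) 1 := fun a j => (hr a j).1
  have hr01' : ∀ a j, r' a j ∈ Set.Icc (0 : ℝ) 1 := fun a j => (hr' a j).1
  have hρ1 : ρ ≤ 1 := (havg h₁).le_one hr01'
  have hT' : (0 : ℝ) < T := by exact_mod_cast hT
  have hg : (cumReward π₀ r h₁ T - Δ) / T ≤ ρ := by
    rw [div_le_iff₀ hT']
    have := cumReward_le_of_avgReward_le hr01 hρ1 (fun π' h ρ' => hmax π' r hr h ρ') π₀ h₁ T
    linarith
  have : Nonempty (Hist K Δ) := ⟨h₁⟩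
  obtain ⟨h₀, hh₀⟩ := Finite.exists_min b
  refine ⟨fun h => b h - b h₀, fun h => ⟨sub_nonneg.2 (hh₀ h), ?_, ?_⟩⟩
  · have := bias_le_add hr01' hρ1 (fun h a => (hb h).2 a) h₀ h
    linarith
  · have h1 := (hb h).1
    -- Both tables lie within the confidence radius of `rhat`; twice the factor `10` is the `20` in
    -- `width`.
    have h2 : rewardAt r' h (π h) ≤ rewardAt r h (π h) +
        width (Real.log (K * Δ * t / δ)) (N (π h) (playCount h (π h))) := by
      have e1 := (abs_le.1 (hr (π h) (playCount h (π h))).2).1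
      have e2 := (abs_le.1 (hr' (π h) (playCount h (π h))).2).2
      unfold width rewardAt
      linarith
    change _ ≤ _ + width (Real.log (K * Δ * t / δ)) (N (π h) (playCount h (π h))) + _
    linarith

/-! ### The course of the algorithm -/

/-- A potential summed over all pairs changes in a single term per round, which lets it telescope
along the run. -/
lemma sum_comp_addAt_one (φ : ℕ → ℝ) (v : Table K Δ ℕ) (a : Fin K) (j : Fin (Δ + 1)) :
    ∑ a', ∑ j', φ (addAt v a j 1 a' j')
      = ∑ a', ∑ j', φ (v a' j') + (φ (v a j + 1) - φ (v a j)) := by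
  have h : ∀ a' j', φ (addAt v a j 1 a' j')
      = φ (v a' j') + if a' = a then (if j' = j then φ (v a j + 1) - φ (v a j) else 0) else 0 := by
    intro a' j'
    unfold addAt
    by_cases h1 : a' = a <;> by_cases h2 : j' = j <;> simp [h1, h2]
  simp only [h, Finset.sum_add_distrib]
  simp

/-- The number of visits to each pair so far. -/
def State.totalCount (s : State K Δ) : Table K Δ ℕ := fun a j => s.oldCount a j + s.newCount a j

/-- The historical count of the arm that is played. -/
def State.level (s : State K Δ) : Fin (Δ + 1) := playCount s.hist s.arm

section Step

variable (sel : PolicyRule K Δ) (s : State K Δ) (x : ℝ)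

lemma State.step_round : (s.step sel x).round = s.round + 1 := by
  unfold State.step; split_ifs <;> rfl

lemma State.step_hist : (s.step sel x).hist = nextHist s.hist s.arm := by
  unfold State.step; split_ifs <;> rfl

lemma State.step_rewardSum : (s.step sel x).rewardSum = addAt s.rewardSum s.arm s.level x := by
  unfold State.step; split_ifs <;> rfl

lemma State.record_totalCount :
    (s.record x).totalCount = addAt s.totalCount s.arm s.level 1 := by
  funext a j
  change s.oldCount a j + (if a = s.arm ∧ j = s.level then s.newCount a j + 1 else s.newCount a j)
    = if a = s.arm ∧ j = s.level then s.oldCount a j + s.newCount a j + 1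
      else s.oldCount a j + s.newCount a j
  split_ifs <;> rfl

lemma State.step_totalCount : (s.step sel x).totalCount = addAt s.totalCount s.arm s.level 1 := by
  rw [← s.record_totalCount x]
  unfold State.step; split_ifs
  · rfl
  · funext a j
    simp [State.totalCount, State.newEpisode]

lemma State.step_newCount_lt (a : Fin K) (j : Fin (Δ + 1)) :
    (s.step sel x).newCount a j < max 1 ((s.step sel x).oldCount a j) := by
  unfold State.step; split_ifs with h
  · exact h a j
  · simp [State.newEpisode]

end Step

section Run

variable (sel : PolicyRule K Δ) (r : Table K Δ ℝ) (h₁ : Hist K Δ) (ε : ℕ → ℝ)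

lemma carmabState_succ (t : ℕ) : carmabState sel r h₁ ε (t + 1) =
    (carmabState sel r h₁ ε t).step sel (carmabReward sel r h₁ ε t) := rfl

lemma carmabState_round (t : ℕ) : (carmabState sel r h₁ ε t).round = t + 1 := by
  induction t with
  | zero => rfl
  | succ t ih => rw [carmabState_succ, State.step_round, ih]

lemma carmabState_newCount_lt (t : ℕ) (a : Fin K) (j : Fin (Δ + 1)) :
    (carmabState sel r h₁ ε t).newCount a j < max 1 ((carmabState sel r h₁ ε t).oldCount a j) := by
  cases t with
  | zero => simp [carmabState, State.first]
  | succ t => exact State.step_newCount_lt ..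

/-- The pair `(a, j)` is visited in round `t + 1`. -/
abbrev Visits (t : ℕ) (a : Fin K) (j : Fin (Δ + 1)) : Prop :=
  a = (carmabState sel r h₁ ε t).arm ∧ j = (carmabState sel r h₁ ε t).level

lemma carmabState_totalCount (t : ℕ) (a : Fin K) (j : Fin (Δ + 1)) :
    (carmabState sel r h₁ ε t).totalCount a j
      = ∑ s ∈ Finset.range t, if Visits sel r h₁ ε s a j then 1 else 0 := by
  induction t with
  | zero => simp [carmabState, State.first, State.totalCount]
  | succ t ih =>
    rw [Finset.sum_range_succ, ← ih, carmabState_succ, State.step_totalCount, addAt]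
    by_cases h : Visits sel r h₁ ε t a j
    · rw [if_pos h, if_pos h]
    · rw [if_neg h, if_neg h, add_zero]

/-- This isolates the error of the empirical mean as a sum of noise over the rounds that visit the
pair. -/
lemma carmabState_rewardSum (t : ℕ) (a : Fin K) (j : Fin (Δ + 1)) :
    (carmabState sel r h₁ ε t).rewardSum a j
      = r a j * (carmabState sel r h₁ ε t).totalCount a j
        + ∑ s ∈ Finset.range t, if Visits sel r h₁ ε s a j then ε s else 0 := by
  induction t with
  | zero => simp [carmabState, State.first, State.totalCount]
  | succ t ih =>
    rw [Finset.sum_range_succ, carmabState_succ, State.step_totalCount, State.step_rewardSum,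
      addAt, addAt]
    by_cases h : Visits sel r h₁ ε t a j
    · rw [if_pos h, if_pos h, if_pos h, ih]
      have : carmabReward sel r h₁ ε t = r a j + ε t := by
        rw [h.1, h.2]; rfl
      rw [this]; push_cast; ring
    · rw [if_neg h, if_neg h, if_neg h, ih, add_zero]

lemma carmabState_sum_totalCount (t : ℕ) :
    ∑ a, ∑ j, ((carmabState sel r h₁ ε t).totalCount a j : ℝ) = t := by
  induction t with
  | zero => simp [carmabState, State.first, State.totalCount]
  | succ t ih =>
    rw [carmabState_succ, State.step_totalCount, sum_comp_addAt_one (fun n => (n : ℝ)), ih]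
    push_cast; ring

end Run

/-! ### Potentials that pay for the bonuses and the changes of episode -/

lemma sqrt_inv_le_sqrt_add_one_sub {n M : ℕ} (h : n + 1 ≤ 2 * M) :
    √(1 / M) ≤ 4 * (√(n + 1 : ℕ) - √n) := by
  have hM : (0 : ℝ) < M := by
    have : 0 < M := by omega
    exact_mod_cast this
  have h' : ((n + 1 : ℕ) : ℝ) ≤ 4 * M := by
    have : n + 1 ≤ 4 * M := by omega
    exact_mod_cast this
  have h1 : √(n + 1 : ℕ) ≤ 2 * √M := by
    rw [Real.sqrt_le_left (by positivity), mul_pow, Real.sq_sqrt hM.le]; linarith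
  have h2 : √(n : ℝ) ≤ √(n + 1 : ℕ) := Real.sqrt_le_sqrt (by push_cast; linarith)
  have h3 : √(n + 1 : ℕ) ^ 2 = n + 1 := by rw [Real.sq_sqrt (by positivity)]; push_cast; ring
  have h4 : √(n : ℝ) ^ 2 = n := Real.sq_sqrt (by positivity)
  have h5 : 0 < √(M : ℝ) := Real.sqrt_pos.2 hM
  rw [one_div, Real.sqrt_inv, inv_le_iff_one_le_mul₀ h5]
  -- The increment `√(n + 1) - √n` is at least `1 / (2 √(n + 1))`, and `√(n + 1) ≤ 2 √M`.
  nlinarith [Real.sqrt_nonneg (n : ℝ)]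

/-- Within an episode the total count stays below twice `max 1 n`, so a width frozen at the start of
the episode is still comparable to the current increment of the square root. -/
lemma width_le {L : ℝ} {n m : ℕ} (h : m < max 1 n) :
    width L n ≤ 80 * √L * (√((n + m + 1 : ℕ) : ℝ) - √((n + m : ℕ) : ℝ)) := by
  have h1 := sqrt_inv_le_sqrt_add_one_sub (n := n + m) (M := max 1 n) (by omega)
  rw [width, div_eq_mul_one_div, Real.sqrt_mul' _ (by positivity)]
  nlinarith [Real.sqrt_nonneg L, mul_le_mul_of_nonneg_left h1 (Real.sqrt_nonneg L)]

/-- The visits that end an episode multiply `n + 1` by at least `3 / 2`, and `log (3 / 2) ≥ 1 - 2 /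
3`. -/
lemma third_le_log_sub {n m : ℕ} (h : max 1 n ≤ m) :
    1 / 3 ≤ Real.log ((n + m : ℕ) + 1) - Real.log ((n : ℝ) + 1) := by
  have hm : n + 1 ≤ 2 * m := by omega
  have hm' : (n : ℝ) + 1 ≤ 2 * m := by exact_mod_cast hm
  have hn : (0 : ℝ) < n + 1 := by positivity
  rw [← Real.log_div (by positivity) hn.ne']
  have h1 : (3 : ℝ) / 2 ≤ ((n + m : ℕ) + 1) / ((n : ℝ) + 1) := by
    rw [le_div_iff₀ hn]; push_cast; linarith
  have h2 := Real.one_sub_inv_le_log_of_pos (x := 3 / 2) (by norm_num)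
  have h3 := Real.log_le_log (by norm_num) h1
  norm_num at h2
  linarith

/-- In round `t + 1` the true rewards are feasible for the current visit counts. -/
def TrueFeasible (δ : ℝ) (s : State K Δ) (r : Table K Δ ℝ) : Prop :=
  r ∈ feasible δ s.round s.totalCount (empirical s.rewardSum s.totalCount)

/-- While the true rewards stay feasible, the algorithm gains almost `g` per round, where `g` is
what a fixed policy gains per round over the horizon. -/
lemma gain_le_of_trueFeasible {δ : ℝ} (hδ : 0 < δ) {sel : PolicyRule K Δ}
    (hsel : IsOptimisticRule δ sel) {r : Table K Δ ℝ} {h₁ : Hist K Δ} {ε : ℕ → ℝ} {T : ℕ}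
    (hT : 0 < T) (π₀ : Policy K Δ)
    (hfeas : ∀ t ≤ T, TrueFeasible δ (carmabState sel r h₁ ε t) r) (t : ℕ) (ht : t ≤ T) :
    ∃ b, IsCertificate ((cumReward π₀ r h₁ T - Δ) / T) r
        (fun a j => width (Real.log (K * Δ * (T + 1 : ℕ) / δ))
          ((carmabState sel r h₁ ε t).oldCount a j)) (carmabState sel r h₁ ε t).policy b ∧
      (cumReward π₀ r h₁ T - Δ) / T * t ≤
        ∑ s ∈ Finset.range t,
            rewardAt r (carmabState sel r h₁ ε s).hist (carmabState sel r h₁ ε s).arm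
          + 80 * √(Real.log (K * Δ * (T + 1 : ℕ) / δ))
            * ∑ a, ∑ j, √((carmabState sel r h₁ ε t).totalCount a j : ℝ)
          + b (carmabState sel r h₁ ε t).hist
          + 3 * Δ * ∑ a, ∑ j, Real.log ((carmabState sel r h₁ ε t).oldCount a j + 1) := by
  set L := Real.log (K * Δ * (T + 1 : ℕ) / δ) with hL
  set g := (cumReward π₀ r h₁ T - Δ) / T with hg
  -- A policy computed afresh at time `t` would have a certificate. All widths are enlarged to the
  -- confidence level of round `T + 1`, so that one constant `L` serves every episode.
  have hcert : ∀ t ≤ T, ∃ b, IsCertificate g r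
      (fun a j => width L ((carmabState sel r h₁ ε t).totalCount a j))
      (sel (carmabState sel r h₁ ε t).round (carmabState sel r h₁ ε t).totalCount
        (empirical (carmabState sel r h₁ ε t).rewardSum
          (carmabState sel r h₁ ε t).totalCount)) b := by
    intro t ht
    obtain ⟨b, hb⟩ := exists_isCertificate (π₀ := π₀) (h₁ := h₁) hT (hfeas t ht)
      (hsel.optimistic _ _ _ ⟨r, hfeas t ht⟩)
    refine ⟨b, fun h => ⟨(hb h).1, (hb h).2.1, (hb h).2.2.trans ?_⟩⟩
    gcongr
    refine width_mono ?_ _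
    rw [carmabState_round]
    rcases Nat.eq_zero_or_pos K with hK | hK
    · subst hK; simp [hL]
    rcases Nat.eq_zero_or_pos Δ with hΔ | hΔ
    · subst hΔ; simp [hL]
    refine Real.log_le_log (by positivity) ?_
    gcongr
  induction t with
  | zero =>
    obtain ⟨b, hb⟩ := hcert 0 (Nat.zero_le _)
    refine ⟨b, ?_, ?_⟩
    · exact hb
    · simpa [carmabState, State.first, State.totalCount] using (hb h₁).1
  | succ t ih =>
    obtain ⟨b, hb, hgain⟩ := ih (by omega)
    have hnew := hcert (t + 1) ht
    have hlt := carmabState_newCount_lt sel r h₁ ε t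
    have htot : (carmabState sel r h₁ ε (t + 1)).totalCount = _ := State.step_totalCount ..
    have hhist : (carmabState sel r h₁ ε (t + 1)).hist = _ := State.step_hist ..
    have hstep : carmabState sel r h₁ ε (t + 1) = _ :=
      carmabState_succ sel r h₁ ε t
    set s := carmabState sel r h₁ ε t with hs
    set x := carmabReward sel r h₁ ε t with hx
    have hround := (hb s.hist).2.2
    have hw : rewardAt (fun a j => width L (s.oldCount a j)) s.hist (s.policy s.hist)
        ≤ 80 * √L * (√((s.totalCount s.arm s.level + 1 : ℕ) : ℝ)
            - √((s.totalCount s.arm s.level : ℕ) : ℝ)) :=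
      width_le (hlt _ _)
    -- One more round under the certificate of the running episode; its width is absorbed by the
    -- growth of the square root potential.
    have hprog : g * (t + 1 : ℕ) ≤
        ∑ s ∈ Finset.range (t + 1),
            rewardAt r (carmabState sel r h₁ ε s).hist (carmabState sel r h₁ ε s).arm
          + 80 * √L
            * ∑ a, ∑ j, √((carmabState sel r h₁ ε (t + 1)).totalCount a j : ℝ)
          + b (carmabState sel r h₁ ε (t + 1)).hist
          + 3 * Δ * ∑ a, ∑ j, Real.log (s.oldCount a j + 1) := by
      rw [Finset.sum_range_succ, htot, hhist, sum_comp_addAt_one (fun n => √(n : ℝ)), ← hs]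
      push_cast at hw ⊢
      change _ ≤ rewardAt r s.hist s.arm + _ + b (nextHist s.hist s.arm) at hround
      linarith
    by_cases hcont : ∀ a j, (s.record x).newCount a j < max 1 ((s.record x).oldCount a j)
    · have hstep' : s.step sel x = s.record x := by rw [State.step, if_pos hcont]
      have hold : (carmabState sel r h₁ ε (t + 1)).oldCount = s.oldCount := by
        rw [hstep, hstep']; rfl
      have hpol : (carmabState sel r h₁ ε (t + 1)).policy = s.policy := by
        rw [hstep, hstep']; rfl
      rw [hold, hpol]
      exact ⟨b, hb, hprog⟩
    · have hstep' : s.step sel x = (s.record x).newEpisode sel := by rw [State.step, if_neg hcont]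
      -- At the start of an episode the old counts are the total counts, so `hcert` speaks of the
      -- policy just selected.
      have htot' : (carmabState sel r h₁ ε (t + 1)).totalCount
          = (carmabState sel r h₁ ε (t + 1)).oldCount := by
        rw [hstep, hstep']; funext a j; simp [State.totalCount, State.newEpisode]
      have hold : (carmabState sel r h₁ ε (t + 1)).oldCount
          = fun a j => s.oldCount a j + (s.record x).newCount a j := by
        rw [hstep, hstep']; rfl
      have hpol : (carmabState sel r h₁ ε (t + 1)).policy =
          sel (carmabState sel r h₁ ε (t + 1)).round (carmabState sel r h₁ ε (t + 1)).totalCount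
        (empirical (carmabState sel r h₁ ε (t + 1)).rewardSum
          (carmabState sel r h₁ ε (t + 1)).totalCount) := by
        rw [htot', hstep, hstep']; rfl
      obtain ⟨b', hb'⟩ := hnew
      rw [← hpol, htot'] at hb'
      refine ⟨b', hb', hprog.trans ?_⟩
      have h1 := (hb (carmabState sel r h₁ ε (t + 1)).hist).2.1
      have h2 := (hb' (carmabState sel r h₁ ε (t + 1)).hist).1
      -- The pair that ended the episode raises the potential by `1 / 3`. With the factor `3 Δ` this
      -- pays for replacing `b` by `b'`, since both take values in `[0, Δ]`.
      have h3 : ∑ a, ∑ j, Real.log (s.oldCount a j + 1) + 1 / 3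
          ≤ ∑ a, ∑ j, Real.log ((carmabState sel r h₁ ε (t + 1)).oldCount a j + 1) := by
        push Not at hcont
        obtain ⟨a, j, haj⟩ := hcont
        have hle : ∀ a j, Real.log (s.oldCount a j + 1)
            ≤ Real.log ((carmabState sel r h₁ ε (t + 1)).oldCount a j + 1) := by
          intro a j
          refine Real.log_le_log (by positivity) ?_
          rw [hold]; push_cast
          have : (0 : ℝ) ≤ ((s.record x).newCount a j : ℕ) := Nat.cast_nonneg _
          linarith
        have haj' : 1 / 3 ≤ Real.log ((carmabState sel r h₁ ε (t + 1)).oldCount a j + 1)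
            - Real.log (s.oldCount a j + 1) := by
          rw [hold]; exact third_le_log_sub haj
        have e1 := Finset.single_le_sum (s := Finset.univ)
          (f := fun j => Real.log ((carmabState sel r h₁ ε (t + 1)).oldCount a j + 1)
            - Real.log (s.oldCount a j + 1)) (fun j _ => sub_nonneg.2 (hle a j))
          (Finset.mem_univ j)
        have e2 := Finset.single_le_sum (s := Finset.univ)
          (f := fun a => ∑ j, (Real.log ((carmabState sel r h₁ ε (t + 1)).oldCount a j + 1)
            - Real.log (s.oldCount a j + 1)))
          (fun a _ => Finset.sum_nonneg fun j _ => sub_nonneg.2 (hle a j))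
          (Finset.mem_univ a)
        simp only [Finset.sum_sub_distrib] at e1 e2
        linarith
      have h4 : (0 : ℝ) ≤ Δ := Nat.cast_nonneg _
      nlinarith

/-- Cauchy–Schwarz over the `K (Δ + 1)` pairs. -/
lemma sum_sum_sqrt_le (N : Table K Δ ℕ) :
    ∑ a, ∑ j, √(N a j : ℝ) ≤ √((K * (Δ + 1)) * ∑ a, ∑ j, (N a j : ℝ)) := by
  refine Real.le_sqrt_of_sq_le ?_
  have := sq_sum_le_card_mul_sum_sq (s := (Finset.univ : Finset (Fin K × Fin (Δ + 1))))
    (f := fun p => √(N p.1 p.2 : ℝ))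
  simp only [Real.sq_sqrt (Nat.cast_nonneg _), Fintype.sum_prod_type] at this
  simpa using this

lemma sum_sum_log_le (hK : 0 < K) (N : Table K Δ ℕ) {T : ℝ} (hT : 0 ≤ T)
    (hN : ∑ a, ∑ j, (N a j : ℝ) ≤ T) :
    ∑ a, ∑ j, Real.log (N a j + 1) ≤ K * (Δ + 1) * Real.log (1 + T / (K * (Δ + 1))) := by
  have hK' : (0 : ℝ) < K := by exact_mod_cast hK
  set S : ℝ := K * (Δ + 1) with hS
  have hS0 : 0 < S := by positivity
  set y := 1 + T / S with hy
  have hy0 : 0 < y := by positivity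
  -- The tangent to the logarithm at `y`, the value of `N + 1` when `T` visits are spread evenly;
  -- the linear terms sum to at most `0`.
  have h1 : ∀ a j, Real.log (N a j + 1) ≤ Real.log y + ((N a j + 1) / y - 1) := by
    intro a j
    have := Real.log_le_sub_one_of_pos (x := ((N a j : ℝ) + 1) / y) (by positivity)
    rw [Real.log_div (by positivity) hy0.ne'] at this
    linarith
  refine (Finset.sum_le_sum fun a _ => Finset.sum_le_sum fun j _ => h1 a j).trans ?_
  simp only [Finset.sum_add_distrib, Finset.sum_sub_distrib, ← Finset.sum_div,
    Finset.sum_const, Finset.card_univ, Fintype.card_fin, nsmul_eq_mul, mul_one]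
  push_cast
  have h2 : (∑ a, ∑ j, (N a j : ℝ) + K * (Δ + 1)) / y ≤ S := by
    rw [div_le_iff₀ hy0, hy, ← hS]
    have : S * (1 + T / S) = S + T := by field_simp
    linarith
  rw [← hS] at h2
  have h3 : (K : ℝ) * ((Δ + 1) * Real.log y) = S * Real.log y := by rw [hS]; ring
  rw [h3, ← hS]
  linarith

/-- The regret against a fixed policy, without the noise, while the true rewards are feasible. -/
lemma cumReward_sub_le {δ : ℝ} (hδ : 0 < δ) {sel : PolicyRule K Δ}
    (hsel : IsOptimisticRule δ sel) {r : Table K Δ ℝ} {h₁ : Hist K Δ} {ε : ℕ → ℝ} {T : ℕ}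
    (hK : 0 < K) (hT : 0 < T) (π₀ : Policy K Δ)
    (hfeas : ∀ t ≤ T, TrueFeasible δ (carmabState sel r h₁ ε t) r) :
    cumReward π₀ r h₁ T - ∑ s ∈ Finset.range T,
            rewardAt r (carmabState sel r h₁ ε s).hist (carmabState sel r h₁ ε s).arm ≤
      80 * √(Real.log (K * Δ * (T + 1 : ℕ) / δ)) * √((K * (Δ + 1)) * T) + 2 * Δ
        + 3 * Δ * (K * (Δ + 1) * Real.log (1 + T / (K * (Δ + 1)))) := by
  obtain ⟨b, hb, hgain⟩ := gain_le_of_trueFeasible hδ hsel hT π₀ hfeas T le_rfl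
  have hT' : (0 : ℝ) < T := by exact_mod_cast hT
  rw [div_mul_cancel₀ _ hT'.ne'] at hgain
  have hsum := carmabState_sum_totalCount sel r h₁ ε T
  have h1 := sum_sum_sqrt_le (carmabState sel r h₁ ε T).totalCount
  rw [hsum] at h1
  have h2 := sum_sum_log_le hK (carmabState sel r h₁ ε T).oldCount hT'.le (by
    rw [← hsum]
    gcongr with a _ j _
    exact Nat.le_add_right _ _)
  have h3 := (hb (carmabState sel r h₁ ε T).hist).2.1
  have h4 := mul_le_mul_of_nonneg_left h1
    (by positivity : 0 ≤ 80 * √(Real.log (K * Δ * (T + 1 : ℕ) / δ)))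
  have h5 := mul_le_mul_of_nonneg_left h2 (by positivity : (0 : ℝ) ≤ 3 * Δ)
  linarith

/-! ### Predictable sums of Gaussian noise -/

section Noise

variable {Ω : Type*}

/-- The `σ`-algebra generated by the noise before time `t`. -/
abbrev past (ε : ℕ → Ω → ℝ) (t : ℕ) : MeasurableSpace Ω :=
  ⨆ s ∈ Set.Iio t, MeasurableSpace.comap (ε s) inferInstance

lemma past_mono (ε : ℕ → Ω → ℝ) {t t' : ℕ} (h : t ≤ t') : past ε t ≤ past ε t' :=
  biSup_mono fun _ hs => lt_of_lt_of_le hs h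

lemma measurable_past (ε : ℕ → Ω → ℝ) {s t : ℕ} (h : s < t) : Measurable[past ε t] (ε s) :=
  Measurable.mono (comap_measurable (ε s))
    (le_iSup₂ (f := fun s (_ : s ∈ Set.Iio t) => MeasurableSpace.comap (ε s) inferInstance) s h)
    le_rfl

/-- The sum of the noise at the times that are selected by the events `A`. -/
def noiseSum (ε : ℕ → Ω → ℝ) (A : ℕ → Set Ω) (t : ℕ) (ω : Ω) : ℝ :=
  ∑ s ∈ Finset.range t, (A s).indicator (ε s) ω

/-- The number of times that are selected by the events `A`. -/
def selectCount (A : ℕ → Set Ω) (t : ℕ) (ω : Ω) : ℝ :=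
  ∑ s ∈ Finset.range t, (A s).indicator 1 ω

lemma measurable_noiseSum_past {ε : ℕ → Ω → ℝ} {A : ℕ → Set Ω}
    (hA : ∀ t, MeasurableSet[past ε t] (A t)) (t : ℕ) :
    Measurable[past ε t] (noiseSum ε A t) := by
  refine Finset.measurable_sum _ fun s hs => ?_
  rw [Finset.mem_range] at hs
  exact (measurable_past ε hs).indicator (past_mono ε hs.le _ (hA s))

lemma measurable_selectCount_past {ε : ℕ → Ω → ℝ} {A : ℕ → Set Ω}
    (hA : ∀ t, MeasurableSet[past ε t] (A t)) (t : ℕ) :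
    Measurable[past ε t] (selectCount A t) := by
  refine Finset.measurable_sum _ fun s hs => ?_
  rw [Finset.mem_range] at hs
  let := past ε t
  exact measurable_one.indicator (past_mono ε hs.le _ (hA s))

variable [mΩ : MeasurableSpace Ω] {P : Measure Ω} {ε : ℕ → Ω → ℝ}

lemma past_le (hε : ∀ t, Measurable (ε t)) (t : ℕ) : past ε t ≤ mΩ :=
  iSup₂_le fun s _ => (hε s).comap_le

lemma indep_past (hε : ∀ t, Measurable (ε t)) (hind : iIndepFun ε P) (t : ℕ) :
    Indep (past ε t) (MeasurableSpace.comap (ε t) inferInstance) P := by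
  have := indep_iSup_of_disjoint (S := Set.Iio t) (T := {t}) (fun s => (hε s).comap_le) hind
    (by simp)
  simpa [past] using this

lemma lintegral_exp_gaussian (hg : ∀ t, P.map (ε t) = gaussianReal 0 1) (l : ℝ) (t : ℕ) :
    ∫⁻ ω, ENNReal.ofReal (Real.exp (l * ε t ω - l ^ 2 / 2)) ∂P = 1 := by
  have hm : ∫ ω, Real.exp (l * ε t ω - l ^ 2 / 2) ∂P = 1 := by
    have := mgf_gaussianReal (hg t) l
    rw [mgf] at this
    simp only [Real.exp_sub, integral_div, this]
    norm_num
  rw [← ofReal_integral_eq_lintegral_ofReal (Integrable.of_integral_ne_zero (by rw [hm]; simp))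
    (Eventually.of_forall fun _ => (Real.exp_pos _).le), hm, ENNReal.ofReal_one]

/-- This is the exponential martingale: off `A t` nothing changes, and on `A t` the factor gained is
independent of the past and has mean `1`. -/
lemma lintegral_exp_noiseSum [IsProbabilityMeasure P] (hε : ∀ t, Measurable (ε t))
    (hind : iIndepFun ε P) (hg : ∀ t, P.map (ε t) = gaussianReal 0 1) {A : ℕ → Set Ω}
    (hA : ∀ t, MeasurableSet[past ε t] (A t)) (l : ℝ) (t : ℕ) :
    ∫⁻ ω, ENNReal.ofReal
      (Real.exp (l * noiseSum ε A t ω - l ^ 2 / 2 * selectCount A t ω)) ∂P = 1 := by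
  induction t with
  | zero => simp [noiseSum, selectCount]
  | succ t ih =>
    set Z : Ω → ENNReal := fun ω => ENNReal.ofReal
      (Real.exp (l * noiseSum ε A t ω - l ^ 2 / 2 * selectCount A t ω)) with hZ
    set W : Ω → ENNReal := fun ω => ENNReal.ofReal (Real.exp (l * ε t ω - l ^ 2 / 2)) with hW
    have hZm : Measurable[past ε t] Z :=
      ENNReal.measurable_ofReal.comp (Real.measurable_exp.comp
        (((measurable_noiseSum_past hA t).const_mul l).sub
          ((measurable_selectCount_past hA t).const_mul _)))
    have hWm : Measurable[MeasurableSpace.comap (ε t) inferInstance] W :=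
      ENNReal.measurable_ofReal.comp (Real.measurable_exp.comp
        (((comap_measurable (ε t)).const_mul l).sub_const _))
    have hsplit : ∀ ω, ENNReal.ofReal
        (Real.exp (l * noiseSum ε A (t + 1) ω - l ^ 2 / 2 * selectCount A (t + 1) ω))
          = (A t)ᶜ.indicator Z ω + (A t).indicator Z ω * W ω := by
      intro ω
      by_cases hω : ω ∈ A t
      · simp only [noiseSum, selectCount, Finset.sum_range_succ, Set.indicator_of_mem hω,
          Set.indicator_of_notMem (Set.notMem_compl_iff.2 hω), zero_add, hZ, hW, Pi.one_apply]
        rw [← ENNReal.ofReal_mul (Real.exp_pos _).le, ← Real.exp_add]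
        congr 2; ring
      · simp only [noiseSum, selectCount, Finset.sum_range_succ, Set.indicator_of_notMem hω,
          Set.indicator_of_mem (Set.mem_compl hω), add_zero, zero_mul, hZ]
    have hle := past_le hε t
    have hZA : Measurable[past ε t] ((A t).indicator Z) := hZm.indicator (hA t)
    have hZm' : Measurable Z := hZm.mono hle le_rfl
    have hAm : MeasurableSet (A t) := hle _ (hA t)
    simp only [hsplit]
    rw [lintegral_add_left (hZm'.indicator hAm.compl),
      lintegral_mul_eq_lintegral_mul_lintegral_of_independent_measurableSpace hle
        (hε t).comap_le (indep_past hε hind t) hZA hWm, lintegral_exp_gaussian hg, mul_one,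
      lintegral_indicator hAm, lintegral_indicator hAm.compl, add_comm, lintegral_add_compl _ hAm,
      ih]

/-- The exponential tail bound for predictable sums of Gaussian noise. -/
lemma measure_noiseSum_ge_le [IsProbabilityMeasure P] (hε : ∀ t, Measurable (ε t))
    (hind : iIndepFun ε P) (hg : ∀ t, P.map (ε t) = gaussianReal 0 1) {A : ℕ → Set Ω}
    (hA : ∀ t, MeasurableSet[past ε t] (A t)) (l : ℝ) (t : ℕ) (x : ℝ) :
    P {ω | x ≤ l * noiseSum ε A t ω - l ^ 2 / 2 * selectCount A t ω}
      ≤ ENNReal.ofReal (Real.exp (-x)) := by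
  have hle := past_le hε t
  have hmeas : Measurable fun ω => ENNReal.ofReal
      (Real.exp (l * noiseSum ε A t ω - l ^ 2 / 2 * selectCount A t ω)) :=
    ENNReal.measurable_ofReal.comp (Real.measurable_exp.comp
      ((((measurable_noiseSum_past hA t).mono hle le_rfl).const_mul l).sub
        (((measurable_selectCount_past hA t).mono hle le_rfl).const_mul _)))
  have h := meas_ge_le_lintegral_div (μ := P) hmeas.aemeasurable
    (ε := ENNReal.ofReal (Real.exp x)) (by simp [Real.exp_pos]) ENNReal.ofReal_ne_top
  rw [lintegral_exp_noiseSum hε hind hg hA, one_div,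
    ← ENNReal.ofReal_inv_of_pos (Real.exp_pos x), ← Real.exp_neg] at h
  refine (measure_mono fun ω hω => ?_).trans h
  exact ENNReal.ofReal_le_ofReal (Real.exp_le_exp.2 hω)

/-- The Gaussian tail of a predictable sum of noise in which the number of terms is known. -/
lemma measure_abs_noiseSum_gt_le [IsProbabilityMeasure P] (hε : ∀ t, Measurable (ε t))
    (hind : iIndepFun ε P) (hg : ∀ t, P.map (ε t) = gaussianReal 0 1) {A : ℕ → Set Ω}
    (hA : ∀ t, MeasurableSet[past ε t] (A t)) (t : ℕ) {n y : ℝ} (hn : 0 < n) (hy : 0 ≤ y) :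
    P {ω | selectCount A t ω = n ∧ √(2 * y * n) < |noiseSum ε A t ω|}
      ≤ 2 * ENNReal.ofReal (Real.exp (-y)) := by
  -- This `l` maximizes `l x - l² n / 2` at `x = √(2 y n)`, with maximum `y`. The lower tail uses
  -- `-l`.
  set l := √(2 * y / n) with hl
  have hl2 : l ^ 2 * n = 2 * y := by
    rw [hl, Real.sq_sqrt (by positivity)]; field_simp
  have hlx : l * √(2 * y * n) = 2 * y := by
    rw [hl, ← Real.sqrt_mul (by positivity),
      show 2 * y / n * (2 * y * n) = (2 * y) ^ 2 by field_simp, Real.sqrt_sq (by positivity)]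
  have hl0 : 0 ≤ l := Real.sqrt_nonneg _
  rw [two_mul (ENNReal.ofReal _)]
  refine (measure_mono ?_).trans ((measure_union_le _ _).trans (add_le_add
    (measure_noiseSum_ge_le hε hind hg hA l t y) (measure_noiseSum_ge_le hε hind hg hA (-l) t y)))
  rintro ω ⟨hω, hgt⟩
  simp only [Set.mem_union, Set.mem_ofPred_eq, hω]
  rcases lt_abs.1 hgt with h | h
  · left; nlinarith
  · right; nlinarith

end Noise

/-! ### Measurability of the algorithm -/

/-- The part of the state that takes only countably many values. -/
def State.discrete (s : State K Δ) : ℕ × Hist K Δ × Policy K Δ × Table K Δ ℕ × Table K Δ ℕ :=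
  (s.round, s.hist, s.policy, s.oldCount, s.newCount)

/-- A random state whose components are measurable. -/
structure MeasurableState {Ω : Type*} [MeasurableSpace Ω] (s : Ω → State K Δ) : Prop where
  discrete : Measurable fun ω => (s ω).discrete
  rewardSum : Measurable fun ω => (s ω).rewardSum

lemma MeasurableState.mono {Ω : Type*} {s : Ω → State K Δ} {m m' : MeasurableSpace Ω}
    (h : m ≤ m') (hs : @MeasurableState K Δ Ω m s) :
    @MeasurableState K Δ Ω m' s :=
  @MeasurableState.mk K Δ Ω m' s 
    ((@MeasurableState.discrete K Δ Ω m s hs).mono h le_rfl)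
    ((@MeasurableState.rewardSum K Δ Ω m s hs).mono h le_rfl)

namespace MeasurableState

variable {Ω : Type*} [MeasurableSpace Ω] {s s' : Ω → State K Δ}

lemma comp_discrete (hs : MeasurableState s) {β : Type*} [MeasurableSpace β]
    (F : ℕ × Hist K Δ × Policy K Δ × Table K Δ ℕ × Table K Δ ℕ → β) :
    Measurable fun ω => F (s ω).discrete :=
  (Measurable.of_discrete (f := F)).comp hs.discrete

lemma ite (hs : MeasurableState s) (hs' : MeasurableState s') {p : Ω → Prop} [DecidablePred p]
    (hp : MeasurableSet {ω | p ω}) : MeasurableState fun ω => if p ω then s ω else s' ω := by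
  constructor
  · simp only [apply_ite State.discrete]
    exact Measurable.ite hp hs.discrete hs'.discrete
  · simp only [apply_ite State.rewardSum]
    exact Measurable.ite hp hs.rewardSum hs'.rewardSum

lemma measurableSet_visit (hs : MeasurableState s) (a : Fin K) (j : Fin (Δ + 1)) :
    MeasurableSet {ω | a = (s ω).arm ∧ j = (s ω).level} :=
  hs.discrete (MeasurableSet.of_discrete
    (s := {d : ℕ × Hist K Δ × Policy K Δ × Table K Δ ℕ × Table K Δ ℕ |
      a = d.2.2.1 d.2.1 ∧ j = playCount d.2.1 (d.2.2.1 d.2.1)}))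

lemma record (hs : MeasurableState s) {x : Ω → ℝ} (hx : Measurable x) :
    MeasurableState fun ω => (s ω).record (x ω) := by
  constructor
  · exact hs.comp_discrete fun d => (d.1 + 1, nextHist d.2.1 (d.2.2.1 d.2.1), d.2.2.1, d.2.2.2.1,
      addAt d.2.2.2.2 (d.2.2.1 d.2.1) (playCount d.2.1 (d.2.2.1 d.2.1)) 1)
  · refine measurable_pi_lambda _ fun a => measurable_pi_lambda _ fun j => ?_
    have hS : Measurable fun ω => (s ω).rewardSum a j :=
      (measurable_pi_apply j).comp ((measurable_pi_apply a).comp hs.rewardSum)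
    exact Measurable.ite (hs.measurableSet_visit a j) (hS.add hx) hS

lemma measurable_empirical (N : Table K Δ ℕ) : Measurable fun S => empirical S N :=
  measurable_pi_lambda _ fun a => measurable_pi_lambda _ fun j =>
    ((measurable_pi_apply j).comp (measurable_pi_apply a)).div_const _

lemma newEpisode (hs : MeasurableState s) {sel : PolicyRule K Δ}
    (hsel : ∀ t N, Measurable (sel t N)) : MeasurableState fun ω => (s ω).newEpisode sel := by
  constructor
  -- The round and the counts take countably many values, so measurability in the reward sums for
  -- each fixed value suffices.
  · have hpol : Measurable fun q : (ℕ × Table K Δ ℕ) × Table K Δ ℝ =>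
        sel q.1.1 q.1.2 (empirical q.2 q.1.2) :=
      measurable_from_prod_countable_right fun q =>
        (hsel q.1 q.2).comp (measurable_empirical q.2)
    have h1 := hpol.comp ((hs.comp_discrete fun d =>
      (d.1, (fun a j => d.2.2.2.1 a j + d.2.2.2.2 a j : Table K Δ ℕ))).prodMk hs.rewardSum)
    exact (hs.comp_discrete fun d => d.1).prodMk ((hs.comp_discrete fun d => d.2.1).prodMk
      (h1.prodMk (hs.comp_discrete fun d =>
        ((fun a j => d.2.2.2.1 a j + d.2.2.2.2 a j : Table K Δ ℕ),
          (fun _ _ => 0 : Table K Δ ℕ)))))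
  · exact hs.rewardSum

lemma step (hs : MeasurableState s) {sel : PolicyRule K Δ}
    (hsel : ∀ t N, Measurable (sel t N)) {x : Ω → ℝ} (hx : Measurable x) :
    MeasurableState fun ω => (s ω).step sel (x ω) :=
  (hs.record hx).ite ((hs.record hx).newEpisode hsel) ((hs.record hx).discrete
    (MeasurableSet.of_discrete (s := {d : ℕ × Hist K Δ × Policy K Δ × Table K Δ ℕ × Table K Δ ℕ |
      ∀ a j, d.2.2.2.2 a j < max 1 (d.2.2.2.1 a j)})))

end MeasurableState

lemma measurableState_carmabState {Ω : Type*} (ε : ℕ → Ω → ℝ) {sel : PolicyRule K Δ}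
    (hsel : ∀ t N, Measurable (sel t N)) (r : Table K Δ ℝ) (h₁ : Hist K Δ) (t : ℕ) :
    @MeasurableState K Δ Ω (past ε t) fun ω => carmabState sel r h₁ (fun s => ε s ω) t := by
  induction t with
  | zero =>
    let := past ε 0
    exact ⟨measurable_const (a := (State.first sel h₁).discrete),
      measurable_const (a := (State.first sel h₁).rewardSum)⟩
  | succ t ih =>
    let := past ε (t + 1)
    have ih' : MeasurableState fun ω => carmabState sel r h₁ (fun s => ε s ω) t :=
      ih.mono (past_mono ε t.le_succ)
    have hrew : Measurable fun ω => rewardAt r (carmabState sel r h₁ (fun s => ε s ω) t).hist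
        (carmabState sel r h₁ (fun s => ε s ω) t).arm :=
      ih'.comp_discrete fun d => rewardAt r d.2.1 (d.2.2.1 d.2.1)
    exact ih'.step hsel (hrew.add (measurable_past ε t.lt_succ_self))

/-- The visit in round `t + 1` is settled before `ε t` is drawn; this is the predictability that the
noise bounds require. -/
lemma measurableSet_visits {Ω : Type*} (ε : ℕ → Ω → ℝ) {sel : PolicyRule K Δ}
    (hsel : ∀ t N, Measurable (sel t N)) (r : Table K Δ ℝ) (h₁ : Hist K Δ) (t : ℕ)
    (a : Fin K) (j : Fin (Δ + 1)) :
    MeasurableSet[past ε t] {ω | Visits sel r h₁ (fun s => ε s ω) t a j} :=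
  @MeasurableState.measurableSet_visit K Δ Ω (past ε t) _
    (measurableState_carmabState ε hsel r h₁ t) a j

/-! ### Confidence -/

section Confidence

variable {Ω : Type*} [MeasurableSpace Ω] {P : Measure Ω} [IsProbabilityMeasure P] {ε : ℕ → Ω → ℝ}

lemma measureReal_abs_noiseSum_gt_le (hε : ∀ t, Measurable (ε t))
    (hind : iIndepFun ε P) (hg : ∀ t, P.map (ε t) = gaussianReal 0 1) {A : ℕ → Set Ω}
    (hA : ∀ t, MeasurableSet[past ε t] (A t)) (t : ℕ) {n y : ℝ} (hn : 0 < n) (hy : 0 ≤ y) :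
    P.real {ω | selectCount A t ω = n ∧ √(2 * y * n) < |noiseSum ε A t ω|}
      ≤ 2 * Real.exp (-y) := by
  refine ENNReal.toReal_le_of_le_ofReal (by positivity) ?_
  rw [ENNReal.ofReal_mul zero_le_two, ENNReal.ofReal_ofNat]
  exact measure_abs_noiseSum_gt_le hε hind hg hA t hn hy

/-- The sum of all noise is of the order of the square root of the time. -/
lemma measureReal_abs_sum_gt_le (hε : ∀ t, Measurable (ε t))
    (hind : iIndepFun ε P) (hg : ∀ t, P.map (ε t) = gaussianReal 0 1) {T : ℕ} (hT : 0 < T)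
    {y : ℝ} (hy : 0 ≤ y) :
    P.real {ω | √(2 * y * T) < |∑ t ∈ Finset.range T, ε t ω|} ≤ 2 * Real.exp (-y) := by
  have := measureReal_abs_noiseSum_gt_le hε hind hg (A := fun _ => Set.univ)
    (fun _ => MeasurableSet.univ) T (n := T) (by exact_mod_cast hT) hy
  simpa [selectCount, noiseSum] using this

end Confidence

lemma one_le_ten_mul_sqrt {x : ℝ} (hx : 2 ≤ x) : 1 ≤ 10 * √(Real.log x) := by
  have h1 := Real.log_le_log zero_lt_two hx
  have h2 := Real.log_two_gt_d9
  have : (1 / 10 : ℝ) ≤ √(Real.log x) := Real.le_sqrt_of_sq_le (by norm_num at h2 ⊢; linarith)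
  linarith

/-- The `50` is the exponent that the factor `10` of the radius yields: `2 * 50 = 10 ^ 2`. -/
lemma abs_sub_empirical_le {r L M : ℝ} {n : ℕ} (hn : 0 < n) (h : |M| ≤ √(2 * (50 * L) * n)) :
    |r - (r * n + M) / n| ≤ 10 * √(L / n) := by
  have hn' : (0 : ℝ) < n := by exact_mod_cast hn
  have h1 : r - (r * n + M) / n = -(M / n) := by field_simp; ring
  rw [h1, abs_neg, abs_div, abs_of_pos hn', div_le_iff₀ hn']
  refine h.trans_eq ?_
  rw [show 2 * (50 * L) * n = (10 * n) ^ 2 * (L / n) by field_simp; ring,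
    Real.sqrt_mul (by positivity), Real.sqrt_sq (by positivity)]
  ring

/-- The true rewards leave the confidence set only if the noise at some pair is large. -/
lemma trueFeasible_of_noise_le {δ : ℝ} (hδ : 0 < δ) (hδ1 : δ < 1) (hKΔ : 2 ≤ K * Δ)
    {sel : PolicyRule K Δ} {r : Table K Δ ℝ} (hr : ∀ a j, r a j ∈ Set.Icc (0 : ℝ) 1)
    {h₁ : Hist K Δ} {ε : ℕ → ℝ} {t : ℕ}
    (hnoise : ∀ a j, ∀ n ∈ Finset.Icc 1 t, (carmabState sel r h₁ ε t).totalCount a j = n →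
      |∑ s ∈ Finset.range t, if Visits sel r h₁ ε s a j then ε s else 0|
        ≤ √(2 * (50 * Real.log (K * Δ * (t + 1 : ℕ) / δ)) * n)) :
    TrueFeasible δ (carmabState sel r h₁ ε t) r := by
  intro a j
  refine ⟨hr a j, ?_⟩
  rw [empirical, carmabState_round, carmabState_rewardSum]
  have hcount := carmabState_totalCount sel r h₁ ε t a j
  -- At an unvisited pair the empirical reward is `0`, so the radius must be at least `1`; this is
  -- where `2 ≤ K * Δ` enters.
  rcases Nat.eq_zero_or_pos ((carmabState sel r h₁ ε t).totalCount a j) with h0 | hpos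
  · have hnv : ∀ s ∈ Finset.range t, ¬ Visits sel r h₁ ε s a j := by
      intro s hs hv
      rw [h0] at hcount
      have := Finset.sum_eq_zero_iff.1 hcount.symm s hs
      simp [hv] at this
    rw [Finset.sum_eq_zero fun s hs => if_neg (hnv s hs), h0]
    have h2 : (2 : ℝ) ≤ K * Δ := by exact_mod_cast hKΔ
    have h3 : (2 : ℝ) ≤ K * Δ * (t + 1 : ℕ) / δ := by
      rw [le_div_iff₀ hδ]
      have : (1 : ℝ) ≤ (t + 1 : ℕ) := by exact_mod_cast Nat.le_add_left 1 t
      nlinarith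
    have h4 := one_le_ten_mul_sqrt h3
    have h5 : |r a j| ≤ 1 := abs_le.2 ⟨by linarith [(hr a j).1], (hr a j).2⟩
    simpa using h5.trans h4
  · have hle : (carmabState sel r h₁ ε t).totalCount a j ≤ t := by
      rw [hcount]
      calc _ ≤ ∑ _s ∈ Finset.range t, 1 := Finset.sum_le_sum fun s _ => by split_ifs <;> simp
        _ = t := by simp
    rw [max_eq_right hpos]
    exact abs_sub_empirical_le hpos (hnoise a j _ (Finset.mem_Icc.2 ⟨hpos, hle⟩) rfl)

/-- The left side is the union bound at time `t` over `K (Δ + 1)` pairs and `t` possible counts. The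
right side is shaped to telescope in `t`, and the exponent `50` leaves ample room. -/
lemma failure_term_le {δ : ℝ} (hδ : 0 < δ) (hδ1 : δ < 1) (hKΔ : 2 ≤ K * Δ) (t : ℕ) :
    (K * (Δ + 1) * t : ℝ) * (2 * Real.exp (-(50 * Real.log (K * Δ * (t + 1 : ℕ) / δ))))
      ≤ δ / 2 * (1 / (t + 1 : ℕ) - 1 / (t + 2 : ℕ)) := by
  have h2 : (2 : ℝ) ≤ K * Δ := by exact_mod_cast hKΔ
  have hΔ : (1 : ℝ) ≤ Δ := by
    have : 0 < Δ := Nat.pos_of_mul_pos_left (by omega : 0 < K * Δ)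
    exact_mod_cast this
  set x : ℝ := K * Δ * (t + 1 : ℕ) with hx
  have ht : (0 : ℝ) ≤ t := Nat.cast_nonneg t
  have hK : (0 : ℝ) ≤ K := Nat.cast_nonneg K
  have hx1 : (t : ℝ) + 1 ≤ x := by rw [hx]; push_cast; nlinarith
  have hx2 : 2 ≤ x := by rw [hx]; push_cast; nlinarith
  have hx0 : 0 < x := by linarith
  have hexp : Real.exp (-(50 * Real.log (x / δ))) ≤ δ * (1 / x) ^ 50 := by
    have : -(50 * Real.log (x / δ)) = Real.log ((δ / x) ^ 50) := by
      rw [Real.log_pow, ← inv_div, Real.log_inv]; push_cast; ring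
    rw [this, Real.exp_log (by positivity), div_eq_mul_one_div, mul_pow]
    gcongr
    exact pow_le_of_le_one hδ.le hδ1.le (by norm_num)
  have hlin : (K * (Δ + 1) * t : ℝ) ≤ 2 * x := by
    rw [hx]; push_cast
    have : (K : ℝ) * (Δ + 1) ≤ 2 * (K * Δ) := by nlinarith
    nlinarith
  have hpow : (16 : ℝ) ≤ x ^ 47 := by
    calc (16 : ℝ) ≤ 2 ^ 47 := by norm_num
      _ ≤ x ^ 47 := by gcongr
  have hfrac : (1 : ℝ) / (t + 1 : ℕ) - 1 / (t + 2 : ℕ) = 1 / ((t + 1) * (t + 2)) := by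
    push_cast; field_simp; ring
  have hlow : 1 / (2 * x ^ 2) ≤ 1 / (((t : ℝ) + 1) * (t + 2)) := by
    apply one_div_le_one_div_of_le (by positivity)
    nlinarith
  rw [hfrac]
  calc _ ≤ 2 * x * (2 * (δ * (1 / x) ^ 50)) := by gcongr
    _ = δ / 2 * (8 * x * (1 / x) ^ 50) := by ring
    _ ≤ δ / 2 * (1 / (2 * x ^ 2)) := by
        gcongr
        rw [one_div_pow, le_div_iff₀ (by positivity)]
        have : 8 * x * (1 / x ^ 50) * (2 * x ^ 2) = 16 / x ^ 47 := by field_simp; norm_num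
        rw [this]
        exact div_le_one_of_le₀ hpow (by positivity)
    _ ≤ _ := by gcongr

/-- With high probability the true rewards are feasible throughout. -/
lemma measureReal_not_trueFeasible_le {Ω : Type*} [MeasurableSpace Ω] {P : Measure Ω}
    [IsProbabilityMeasure P] {ε : ℕ → Ω → ℝ} (hε : ∀ t, Measurable (ε t))
    (hind : iIndepFun ε P) (hg : ∀ t, P.map (ε t) = gaussianReal 0 1)
    {δ : ℝ} (hδ : 0 < δ) (hδ1 : δ < 1) (hKΔ : 2 ≤ K * Δ)
    {sel : PolicyRule K Δ} (hsel : ∀ t N, Measurable (sel t N))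
    {r : Table K Δ ℝ} (hr : ∀ a j, r a j ∈ Set.Icc (0 : ℝ) 1) (h₁ : Hist K Δ) (T : ℕ) :
    P.real {ω | ¬ ∀ t ≤ T, TrueFeasible δ (carmabState sel r h₁ (fun s => ε s ω) t) r}
      ≤ δ / 2 := by
  set A : Fin K × Fin (Δ + 1) → ℕ → Set Ω := fun p s =>
    {ω | Visits sel r h₁ (fun s => ε s ω) s p.1 p.2} with hA
  set y : ℕ → ℝ := fun t => 50 * Real.log (K * Δ * (t + 1 : ℕ) / δ) with hy
  have hy0 : ∀ t, 0 ≤ y t := by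
    intro t
    refine mul_nonneg (by norm_num) (Real.log_nonneg ?_)
    rw [le_div_iff₀ hδ, one_mul]
    have : 1 ≤ K * Δ * (t + 1) := by nlinarith
    exact hδ1.le.trans (by exact_mod_cast this)
  -- The tail bound needs a deterministic number of terms, so the random count is split according to
  -- its value `n`.
  set S : ℕ → Fin K × Fin (Δ + 1) → ℕ → Set Ω := fun t p n =>
    {ω | selectCount (A p) t ω = n ∧ √(2 * y t * n) < |noiseSum ε (A p) t ω|} with hS
  have hS_le : ∀ t p, ∀ n ∈ Finset.Icc 1 t, P.real (S t p n) ≤ 2 * Real.exp (-y t) := by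
    intro t p n hn
    refine measureReal_abs_noiseSum_gt_le hε hind hg
      (fun s => measurableSet_visits ε hsel r h₁ s p.1 p.2) t ?_ (hy0 t)
    exact_mod_cast (Finset.mem_Icc.1 hn).1
  have hsub : {ω | ¬ ∀ t ≤ T, TrueFeasible δ (carmabState sel r h₁ (fun s => ε s ω) t) r}
      ⊆ ⋃ t ∈ Finset.range (T + 1), ⋃ p ∈ Finset.univ, ⋃ n ∈ Finset.Icc 1 t, S t p n := by
    intro ω hω
    by_contra hnot
    refine hω fun t ht => trueFeasible_of_noise_le hδ hδ1 hKΔ hr fun a j n hn hcount => ?_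
    simp only [Set.mem_iUnion, not_exists] at hnot
    have h := hnot t (Finset.mem_range.2 (by omega)) (a, j) (Finset.mem_univ _) n hn
    have hsel' : selectCount (A (a, j)) t ω = n := by
      rw [← hcount, carmabState_totalCount]
      push_cast
      refine Finset.sum_congr rfl fun s _ => ?_
      by_cases hv : Visits sel r h₁ (fun s => ε s ω) s a j
      · rw [if_pos hv, Set.indicator_of_mem (show ω ∈ A (a, j) s from hv), Pi.one_apply]
      · rw [if_neg hv, Set.indicator_of_notMem (show ω ∉ A (a, j) s from hv)]
    have hsum : noiseSum ε (A (a, j)) t ω = ∑ s ∈ Finset.range t,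
        if Visits sel r h₁ (fun s => ε s ω) s a j then ε s ω else 0 := by
      refine Finset.sum_congr rfl fun s _ => ?_
      by_cases hv : Visits sel r h₁ (fun s => ε s ω) s a j
      · rw [if_pos hv, Set.indicator_of_mem (show ω ∈ A (a, j) s from hv)]
      · rw [if_neg hv, Set.indicator_of_notMem (show ω ∉ A (a, j) s from hv)]
    rw [← hsum]
    exact not_lt.1 fun hlt => h ⟨hsel', hlt⟩
  calc _ ≤ P.real (⋃ t ∈ Finset.range (T + 1), ⋃ p ∈ Finset.univ, ⋃ n ∈ Finset.Icc 1 t, S t p n) :=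
        measureReal_mono hsub (measure_ne_top _ _)
    _ ≤ ∑ t ∈ Finset.range (T + 1), ∑ _p : Fin K × Fin (Δ + 1), ∑ _n ∈ Finset.Icc 1 t,
          2 * Real.exp (-y t) := by
        refine (measureReal_biUnion_finset_le _ _).trans (Finset.sum_le_sum fun t _ => ?_)
        refine (measureReal_biUnion_finset_le _ _).trans (Finset.sum_le_sum fun p _ => ?_)
        exact (measureReal_biUnion_finset_le _ _).trans (Finset.sum_le_sum (hS_le t p))
    _ ≤ ∑ t ∈ Finset.range (T + 1), δ / 2 * (1 / (t + 1 : ℕ) - 1 / (t + 2 : ℕ)) := by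
        refine Finset.sum_le_sum fun t _ => ?_
        refine le_of_eq_of_le ?_ (failure_term_le hδ hδ1 hKΔ t)
        simp [hy, mul_assoc]
    _ = δ / 2 * (1 - 1 / (T + 2 : ℕ)) := by
        rw [← Finset.mul_sum, Finset.sum_range_sub' (fun t => (1 : ℝ) / (t + 1 : ℕ))]
        simp [add_assoc, one_add_one_eq_two]
    _ ≤ δ / 2 := by
        refine mul_le_of_le_one_right (by positivity) ?_
        have : (0 : ℝ) ≤ 1 / (T + 2 : ℕ) := by positivity
        linarith

/-! ### The regret bound -/

lemma half_le_log {x : ℝ} (hx : 2 ≤ x) : 1 / 2 ≤ Real.log x := by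
  have h1 := Real.log_le_log zero_lt_two hx
  have h2 := Real.log_two_gt_d9
  norm_num at h2
  linarith

lemma log_one_add_le {x y : ℝ} (hy : 2 ≤ y) (hx : 0 ≤ x) (hxy : x ≤ y) :
    Real.log (1 + x) ≤ 2 * Real.log y := by
  have : Real.log (y ^ 2) = 2 * Real.log y := by rw [Real.log_pow]; norm_num
  rw [← this]
  exact Real.log_le_log (by linarith) (by nlinarith)

/-- The regret without the noise while the true rewards are feasible, in closed form. -/
lemma cumReward_sub_le_closed {δ : ℝ} (hδ : 0 < δ) (hδ1 : δ < 1) {sel : PolicyRule K Δ}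
    (hsel : IsOptimisticRule δ sel) {r : Table K Δ ℝ} (hr : ∀ a j, r a j ∈ Set.Icc (0 : ℝ) 1)
    {h₁ : Hist K Δ} {ε : ℕ → ℝ} {T : ℕ} (hK : 0 < K) (hΔ : 0 < Δ) (hT : Δ * K < T)
    (π₀ : Policy K Δ)
    (hfeas : 2 ≤ K → ∀ t ≤ T, TrueFeasible δ (carmabState sel r h₁ ε t) r) :
    cumReward π₀ r h₁ T - ∑ s ∈ Finset.range T,
            rewardAt r (carmabState sel r h₁ ε s).hist (carmabState sel r h₁ ε s).arm ≤
      16 * ((Δ : ℝ) ^ 2 * K * Real.log (T / (Δ * K)))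
        + 160 * √(K * Δ * T * Real.log (Δ * K * T / δ)) := by
  have hK' : (1 : ℝ) ≤ K := by exact_mod_cast hK
  have hΔ' : (1 : ℝ) ≤ Δ := by exact_mod_cast hΔ
  have hT' : (Δ : ℝ) * K < T := by exact_mod_cast hT
  have hB : (1 : ℝ) ≤ Δ * K := by nlinarith
  have hT2 : (2 : ℝ) ≤ T := by
    have : 2 ≤ T := by nlinarith
    exact_mod_cast this
  have hx : 2 ≤ (Δ * K * T / δ : ℝ) := by
    rw [le_div_iff₀ hδ]; nlinarith
  set l := Real.log (Δ * K * T / δ) with hl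
  have hl2 : 1 / 2 ≤ l := half_le_log hx
  have hA : 0 ≤ Real.log (T / (Δ * K)) :=
    Real.log_nonneg (by rw [le_div_iff₀ (by positivity)]; linarith)
  -- With one arm all policies coincide, so no confidence is needed. For `K * Δ = 1` the radius at
  -- an unvisited pair can be too small.
  by_cases hK1 : K = 1
  · subst hK1
    have : cumReward π₀ r h₁ T = ∑ s ∈ Finset.range T,
        rewardAt r (carmabState sel r h₁ ε s).hist (carmabState sel r h₁ ε s).arm :=
      Finset.sum_congr rfl fun s _ => congrArg₂ _ (Subsingleton.elim _ _) (Subsingleton.elim _ _)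
    rw [this, sub_self]
    positivity
  -- Here `log (T / (Δ K))` can be close to `0` and cannot absorb the cost of the episodes, but the
  -- trivial bound `T` is already of the order of the square root term.
  by_cases hsmall : (T : ℝ) ≤ 2 * (Δ * K)
  · have h1 := cumReward_le hr π₀ h₁ T
    have h2 : 0 ≤ ∑ s ∈ Finset.range T,
        rewardAt r (carmabState sel r h₁ ε s).hist (carmabState sel r h₁ ε s).arm :=
      Finset.sum_nonneg fun s _ => (hr _ _).1
    have h3 : (T : ℝ) ≤ 160 * √(K * Δ * T * l) := by
      have : (T : ℝ) / 160 ≤ √(K * Δ * T * l) := by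
        refine Real.le_sqrt_of_sq_le ?_
        have e1 : (T : ℝ) * T ≤ T * (2 * (Δ * K)) := by gcongr
        have e2 : (K * Δ * T : ℝ) * (1 / 2) ≤ K * Δ * T * l := by gcongr
        nlinarith
      linarith
    have h4 : 0 ≤ 16 * ((Δ : ℝ) ^ 2 * K * Real.log (T / (Δ * K))) := by positivity
    linarith
  push Not at hsmall
  refine (cumReward_sub_le hδ hsel hK (by omega) π₀ (hfeas (by omega))).trans ?_
  have hy : 2 ≤ (T / (Δ * K) : ℝ) := by
    rw [le_div_iff₀ (by positivity)]; exact hsmall.le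
  set m := Real.log (T / (Δ * K)) with hm
  have hm2 : 1 / 2 ≤ m := half_le_log hy
  have hS : (K * (Δ + 1) : ℝ) ≤ 2 * (K * Δ) := by nlinarith
  have h1 : Real.log (K * Δ * (T + 1 : ℕ) / δ) ≤ 2 * l := by
    have : 2 * l = Real.log ((Δ * K * T / δ) ^ 2) := by rw [Real.log_pow]; norm_num [hl]
    rw [this]
    refine Real.log_le_log (by positivity) ?_
    have e1 : (K * Δ * (T + 1 : ℕ) / δ : ℝ) ≤ 2 * (Δ * K * T / δ) := by
      rw [← mul_div_assoc]
      refine div_le_div_of_nonneg_right ?_ hδ.le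
      push_cast; nlinarith
    nlinarith
  have h2 : √(Real.log (K * Δ * (T + 1 : ℕ) / δ)) * √((K * (Δ + 1)) * T)
      ≤ 2 * √(K * Δ * T * l) := by
    have e1 : √(Real.log (K * Δ * (T + 1 : ℕ) / δ)) ≤ √(2 * l) := Real.sqrt_le_sqrt h1
    have e2 : √((K * (Δ + 1) : ℝ) * T) ≤ √(2 * (K * Δ) * T) := by gcongr
    calc _ ≤ √(2 * l) * √(2 * (K * Δ) * T) := by gcongr
      _ = √(2 ^ 2 * (K * Δ * T * l)) := by
        rw [← Real.sqrt_mul (by linarith)]; congr 1; ring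
      _ = 2 * √(K * Δ * T * l) := by
        rw [Real.sqrt_mul (by norm_num), Real.sqrt_sq (by norm_num)]
  have h3 : Real.log (1 + T / (K * (Δ + 1))) ≤ 2 * m := by
    refine log_one_add_le hy (by positivity) ?_
    exact div_le_div_of_nonneg_left (by positivity) (by positivity) (by nlinarith)
  have h3' : 0 ≤ Real.log (1 + T / (K * (Δ + 1))) :=
    Real.log_nonneg (le_add_of_nonneg_right (by positivity))
  have h4 : 3 * Δ * (K * (Δ + 1) * Real.log (1 + T / (K * (Δ + 1)))) ≤
      3 * Δ * (2 * (K * Δ) * (2 * m)) := by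
    gcongr
  have h5 : (2 * Δ : ℝ) ≤ 4 * (Δ ^ 2 * K * m) := by
    have e1 : (Δ : ℝ) * 1 ≤ Δ * (Δ * K) := by gcongr
    have e2 : (Δ ^ 2 * K : ℝ) * (1 / 2) ≤ Δ ^ 2 * K * m := by gcongr
    nlinarith
  -- The constants are `3 * 2 * 2 + 4 = 16` and `80 * 2 = 160`.
  nlinarith

lemma noise_bound_le {δ : ℝ} (hδ : 0 < δ) (hδ1 : δ < 1) {T : ℕ} (hB : 0 < K * Δ) (hT : 2 ≤ T) :
    √(2 * Real.log (4 / δ) * T) ≤ 2 * √(K * Δ * T * Real.log (Δ * K * T / δ)) := by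
  have hB' : (1 : ℝ) ≤ K * Δ := by exact_mod_cast hB
  have hT' : (2 : ℝ) ≤ T := by exact_mod_cast hT
  have hx : 2 / δ ≤ (Δ * K * T / δ : ℝ) := by
    gcongr
    nlinarith
  have hδ2 : 2 ≤ 2 / δ := by rw [le_div_iff₀ hδ]; linarith
  have h1 : Real.log (4 / δ) ≤ 2 * Real.log (2 / δ) := by
    have : 2 * Real.log (2 / δ) = Real.log ((2 / δ) ^ 2) := by rw [Real.log_pow]; norm_num
    rw [this]
    refine Real.log_le_log (by positivity) ?_
    have : 4 / δ = 2 * (2 / δ) := by ring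
    rw [this]; nlinarith
  have h2 : Real.log (2 / δ) ≤ Real.log (Δ * K * T / δ) := Real.log_le_log (by positivity) hx
  have h3 := half_le_log hδ2
  set l := Real.log (Δ * K * T / δ)
  calc _ ≤ √(2 ^ 2 * (K * Δ * T * l)) := by
        refine Real.sqrt_le_sqrt ?_
        have e1 : (T : ℝ) * l ≤ K * Δ * (T * l) := le_mul_of_one_le_left (by nlinarith) hB'
        have e2 : Real.log (4 / δ) * T ≤ 2 * l * T := by gcongr; linarith
        nlinarith
    _ = _ := by rw [Real.sqrt_mul (by norm_num), Real.sqrt_sq (by norm_num)]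

end CongestedBandit

end

open CongestedBandit
theorem theorem1 :
    ∃ c : ℝ, 0 < c ∧
      ∀ (K Δ T : ℕ) (δ : ℝ), 0 < Δ → Δ * K < T → 0 < δ → δ < 1 →
      ∀ (f : Table K Δ ℝ) (μ : Fin K → ℝ),
        (∀ a j, 0 < f a j ∧ f a j ≤ 1) →
        (∀ a j, f a j * μ a ∈ Set.Icc (0 : ℝ) 1) →
      ∀ (h₁ : Hist K Δ) (sel : PolicyRule K Δ), IsOptimisticRule δ sel →
      ∀ (Ω : Type*) [MeasurableSpace Ω] (P : Measure Ω) [IsProbabilityMeasure P]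
        (ε : ℕ → Ω → ℝ),
        (∀ t, Measurable (ε t)) → iIndepFun ε P → (∀ t, P.map (ε t) = gaussianReal 0 1) →
        1 - δ ≤ P.real {ω |
          policyRegret (meanReward f μ) h₁
              (carmabReward sel (meanReward f μ) h₁ fun t => ε t ω) T ≤
            c * ((Δ : ℝ) ^ 2 * K * Real.log (T / (Δ * K)))
              + c * √(K * Δ * T * Real.log (Δ * K * T / δ))
              + c * √(T * Real.log (1 / δ))} := by
  -- The regret without noise contributes `160` to the square root term; `noise_bound_le` adds `2`
  -- for the noise.
  refine ⟨162, by norm_num, ?_⟩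
  intro K Δ T δ hΔ hT hδ hδ1 f μ _ hr h₁ sel hsel Ω _ P _ ε hε hind hg
  set r := meanReward f μ with hr_def
  have hr' : ∀ a j, r a j ∈ Set.Icc (0 : ℝ) 1 := hr
  have hK : 0 < K := Fin.pos (h₁ ⟨0, hΔ⟩)
  have hB : 0 < K * Δ := Nat.mul_pos hK hΔ
  have hT2 : 2 ≤ T := by nlinarith
  set E₁ : Set Ω :=
    {ω | ¬ (2 ≤ K → ∀ t ≤ T, TrueFeasible δ (carmabState sel r h₁ (fun s => ε s ω) t) r)} with hE₁
  -- The level `log (4 / δ)` turns the two-sided tail into `2 * (δ / 4) = δ / 2`.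
  set E₂ : Set Ω :=
    {ω | √(2 * Real.log (4 / δ) * T) < |∑ t ∈ Finset.range T, ε t ω|} with hE₂
  have hP₁ : P.real E₁ ≤ δ / 2 := by
    by_cases hK2 : 2 ≤ K
    · simp only [hE₁, hK2, forall_const]
      exact measureReal_not_trueFeasible_le hε hind hg hδ hδ1 (by nlinarith) hsel.measurable hr' h₁ T
    · simp only [hE₁, hK2, IsEmpty.forall_iff, not_true_eq_false, Set.ofPred_false,
        measureReal_empty]
      positivity
  have hP₂ : P.real E₂ ≤ δ / 2 := by
    have h4 : 0 ≤ Real.log (4 / δ) :=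
      Real.log_nonneg (by rw [le_div_iff₀ hδ]; linarith)
    refine (measureReal_abs_sum_gt_le hε hind hg (by omega) h4).trans_eq ?_
    rw [← Real.log_inv, inv_div, Real.exp_log (by positivity)]
    ring
  set G : Set Ω := {ω | policyRegret r h₁ (carmabReward sel r h₁ fun t => ε t ω) T ≤
            162 * ((Δ : ℝ) ^ 2 * K * Real.log (T / (Δ * K)))
              + 162 * √(K * Δ * T * Real.log (Δ * K * T / δ))
              + 162 * √(T * Real.log (1 / δ))} with hG
  -- Covering the space and using subadditivity, instead of taking complements, avoids proving `G`
  -- measurable.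
  have hcover : Set.univ ⊆ G ∪ (E₁ ∪ E₂) := by
    intro ω _
    by_contra hω
    simp only [Set.mem_union, not_or] at hω
    obtain ⟨hωG, hω1, hω2⟩ := hω
    refine hωG ?_
    have hfeas := not_not.1 hω1
    have hnoise : |∑ t ∈ Finset.range T, ε t ω| ≤ √(2 * Real.log (4 / δ) * T) := not_lt.1 hω2
    have hsup : (⨆ π : Policy K Δ, cumReward π r h₁ T) ≤ ∑ s ∈ Finset.range T,
          rewardAt r (carmabState sel r h₁ (fun t => ε t ω) s).hist
            (carmabState sel r h₁ (fun t => ε t ω) s).arm +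
        (16 * ((Δ : ℝ) ^ 2 * K * Real.log (T / (Δ * K)))
          + 160 * √(K * Δ * T * Real.log (Δ * K * T / δ))) := by
      have : Nonempty (Policy K Δ) := ⟨fun _ => ⟨0, hK⟩⟩
      refine ciSup_le fun π₀ => ?_
      have := cumReward_sub_le_closed hδ hδ1 hsel hr' hK hΔ hT π₀ hfeas
      linarith
    have hsum : ∑ t ∈ Finset.range T, carmabReward sel r h₁ (fun t => ε t ω) t
        = ∑ s ∈ Finset.range T,
          rewardAt r (carmabState sel r h₁ (fun t => ε t ω) s).hist
            (carmabState sel r h₁ (fun t => ε t ω) s).arm + ∑ t ∈ Finset.range T, ε t ω :=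
      Finset.sum_add_distrib
    have hn := noise_bound_le hδ hδ1 hB hT2
    have hA : 0 ≤ (Δ : ℝ) ^ 2 * K * Real.log (T / (Δ * K)) := by
      have hB' : (0 : ℝ) < Δ * K := by exact_mod_cast (by nlinarith : 0 < Δ * K)
      have : 0 ≤ Real.log (T / (Δ * K)) := Real.log_nonneg (by
        rw [le_div_iff₀ hB', one_mul]; exact_mod_cast hT.le)
      positivity
    have hR := Real.sqrt_nonneg (T * Real.log (1 / δ))
    have habs := neg_abs_le (∑ t ∈ Finset.range T, ε t ω)
    change policyRegret _ _ _ _ ≤ _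
    rw [policyRegret, hsum]
    linarith
  have h1 : 1 ≤ P.real (G ∪ (E₁ ∪ E₂)) := by
    rw [← probReal_univ (μ := P)]
    exact measureReal_mono hcover
  have h2 := measureReal_union_le (μ := P) G (E₁ ∪ E₂)
  have h3 := measureReal_union_le (μ := P) E₁ E₂
  linarith
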